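/- **Setting.** Let $p(\theta)>0$ be a differentiable prior density on $\mathbb R^d$, and let the data be partitioned into $S$ nonempty shards $\mathbf x_s=\{x_{s,1},\dots,x_{s,N_s}\}$ with differentiable likelihoods $\theta\mapsto p(x_{s,i}\mid\theta)>0$. Let $\pi(\theta)\propto p(\theta)\prod_{s,i}p(x_{s,i}\mid\theta)$ be the posterior density (assumed proper), let $f_1,\dots,f_S>0$ with $\sum_s f_s=1$ be the shard selection probabilities, let $q_1,\dots,q_S>0$ be everywhere differentiable surrogates with $\log q_s$ Lipschitz continuous, let $q=\prod_s q_s$, and let $m\ge 1$. Assume that the log-likelihood gradients are bounded within each shard: $\|\nabla\log p(x_{s,i}\mid\theta)\|\le\gamma_s$ for all $s,i,\theta$. For a step size $h>0$, the CG-DSGLD chain $(\theta_t)_{t\ge0}$ is $$\theta_{t+1}=\theta_t+\frac h2\Big(\nabla\log p(\theta_t)+\frac{N_{s_t}}{f_{s_t}m}\sum_{j=1}^m\nabla\log p(x_{s_t,i_{t,j}}\mid\theta_t)+\nabla\log q(\theta_t)-\frac1{f_{s_t}}\nabla\log q_{s_t}(\theta_t)\Big)+\eta_t,$$ where at each step $s_t$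 is drawn with probabilities $f_1,\dots,f_S$, the indices $i_{t,1},\dots,i_{t,m}$ are drawn uniformly with replacement from $\{1,\dots,N_{s_t}\}$, $\eta_t\sim\mathcal N(0,hI)$, all draws at different steps are independent, $\eta_t$ is independent of the mini-batch, and everything is independent of the (possibly random) initial state $\theta_0$. **Regularity conditions.** Let $H\subseteq(0,\infty)$ be a set of step sizes and let $\phi\in C^2(\mathbb R^d)$ be a $\pi$-integrable test function, with $\bar\phi=\int\phi\,\pi\,d\theta$. Let $\psi\in C^3(\mathbb R^d)$ solve the Poisson equation $\mathcal L\psi=\phi-\bar\phi$, where $\mathcal L=\frac12\nabla\log\pi\cdot\nabla+\frac12\Delta$. Suppose there are a measurable $\Gamma:\mathbb R^d\to[0,\infty)$, exponents $p_0,\dots,p_3>0$ and $r\ge0$, and finite constants such that, with $p_*=\max_k p_k$ and for all $\theta,\theta'$: 1. $\|D^k\psi(\theta)\|\le C_k\,\Gamma(\theta)^{p_k}$ for $k=0,1,2,3$, and $\|D^2\phi(\theta)\|\le c\,(1+\Gamma(\theta)^{p_*})$; 2. $\log\pi\in C^3$ and $\|D^j\log\pi(\theta)\|\le c\,(1+\Gamma(\theta)^r)$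 for $j=1,2,3$; 3. for every $0<a\le 2p_*+6r$: $\sup_{h\in H}\sup_{t\ge0}\mathbb E\,\Gamma(\theta_t)^a<\infty$; 4. for every $0<a\le 2p_*+6r$: $\sup_{u\in(0,1)}\Gamma(u\theta+(1-u)\theta')^a\le c_a\,(\Gamma(\theta)^a+\Gamma(\theta')^a)$. **Conclusion.** There is a constant $C$, independent of $T$, $h$ and $\epsilon_1,\dots,\epsilon_S$, such that whenever $\epsilon_1,\dots,\epsilon_S$ satisfy $$\frac1{N_s}\sum_{i=1}^{N_s}\Big\|\nabla\log p(x_{s,i}\mid\theta)-N_s^{-1}\nabla\log q_s(\theta)\Big\|^2\le\epsilon_s^2\qquad\text{for all }s\text{ and }\theta,$$ then, for every $h\in H$ and every integer $T\ge1$, the Monte Carlo estimate $\hat\phi=\frac1T\sum_{t=1}^T\phi(\theta_t)$ of the chain with step size $h$ has a finite mean squared error with $$\mathbb E\big(\hat\phi-\bar\phi\big)^2\le C\left(\frac1{mT}\sum_{s=1}^S\frac{N_s^2}{f_s}\,\epsilon_s^2+\frac1{hT}+h^2\right).$$ -/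

import Mathlib

open MeasureTheory ProbabilityTheory InnerProductSpace
open scoped Gradient

/-- The parameter space `ℝ^d` with its Euclidean norm. -/
abbrev Param (d : ℕ) : Type := EuclideanSpace ℝ (Fin d)

/-- A Bayesian model whose data set is partitioned into `S` nonempty shards, together with the
shard selection probabilities and one surrogate likelihood factor per shard.
`lik y θ` is the likelihood `p(y | θ)`; the prior need not be normalized. -/
structure FederatedModel (X : Type*) (d S : ℕ) where
  /-- shard sizes -/
  N : Fin S → ℕ
  N_pos : ∀ s, 0 < N s
  /-- the data points of each shard -/
  x : (s : Fin S) → Fin (N s) → X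
  /-- shard selection probabilities -/
  f : PMF (Fin S)
  f_ne_zero : ∀ s, f s ≠ 0
  prior : Param d → ℝ
  prior_pos : ∀ θ, 0 < prior θ
  prior_diff : Differentiable ℝ prior
  lik : X → Param d → ℝ
  lik_pos : ∀ s i θ, 0 < lik (x s i) θ
  lik_diff : ∀ s i, Differentiable ℝ (lik (x s i))
  /-- surrogates for the shard likelihoods -/
  q : Fin S → Param d → ℝ
  q_pos : ∀ s θ, 0 < q s θ
  q_diff : ∀ s, Differentiable ℝ (q s)

noncomputable section

namespace FederatedModel

variable {X : Type*} {d S : ℕ} (M : FederatedModel X d S)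

instance (s : Fin S) : NeZero (M.N s) := ⟨(M.N_pos s).ne'⟩

/-- The selection probability of a shard as a real number. -/
def prob (s : Fin S) : ℝ := (M.f s).toReal

/-- The unnormalized posterior density. -/
def post (θ : Param d) : ℝ := M.prior θ * ∏ s, ∏ i, M.lik (M.x s i) θ

/-- The unnormalized log-posterior. -/
def logPost (θ : Param d) : ℝ := Real.log (M.post θ)

/-- The posterior expectation of `φ`. -/
def postMean (φ : Param d → ℝ) : ℝ := (∫ θ, φ θ * M.post θ) / ∫ θ, M.post θ

/-- `∇ log p(x_{s,i} | θ)`. -/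
def gradLik (s : Fin S) (i : Fin (M.N s)) (θ : Param d) : Param d :=
  ∇ (fun η => Real.log (M.lik (M.x s i) η)) θ

/-- `∇ log q_s(θ)`. -/
def gradSurr (s : Fin S) (θ : Param d) : Param d := ∇ (fun η => Real.log (M.q s η)) θ

/-- A shard together with `m` (not necessarily distinct) data points of it. -/
abbrev Batch (m : ℕ) : Type := (s : Fin S) × (Fin m → Fin (M.N s))

/-- The law of a mini-batch: the shard is drawn with the selection probabilities, then `m` points
are drawn from it independently and uniformly, with replacement. -/
def batchPMF (m : ℕ) : PMF (M.Batch m) :=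
  M.f.bind fun s => (PMF.uniformOfFintype (Fin m → Fin (M.N s))).map (Sigma.mk s)

/-- The DSGLD gradient estimator. -/
def dsgldGrad {m : ℕ} (b : M.Batch m) (θ : Param d) : Param d :=
  ∇ (fun η => Real.log (M.prior η)) θ
    + ((M.N b.1 : ℝ) / (M.prob b.1 * m)) • ∑ j, M.gradLik b.1 (b.2 j) θ

/-- The conducive gradient with respect to shard `s`, with `q = ∏ s, q_s`. -/
def conduciveGrad (s : Fin S) (θ : Param d) : Param d :=
  ∇ (fun η => Real.log (∏ s', M.q s' η)) θ - (M.prob s)⁻¹ • M.gradSurr s θ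

/-- The CG-DSGLD chain with constant step size `h`, driven by the initial state `θ₀`, the
mini-batches `B 0, B 1, …` and the standard Gaussian vectors `ξ 0, ξ 1, …`;
the injected noise at each step is `√h • ξ t`, of law `𝒩(0, h I)`. -/
def chain {m : ℕ} {Ω : Type*} (θ₀ : Ω → Param d) (B : ℕ → Ω → M.Batch m)
    (ξ : ℕ → Ω → Param d) (h : ℝ) : ℕ → Ω → Param d
  | 0, ω => θ₀ ω
  | t + 1, ω =>
      chain θ₀ B ξ h t ω
        + (h / 2) • (M.dsgldGrad (B t ω) (chain θ₀ B ξ h t ω)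
            + M.conduciveGrad (B t ω).1 (chain θ₀ B ξ h t ω))
        + Real.sqrt h • ξ t ω

/-- The joint law of the randomness that drives the chain: the pairs `(B t, ξ t)` are i.i.d., with
`B t` a random mini-batch and `ξ t` an independent standard Gaussian vector, and they are
independent of the initial state. -/
structure IsDriving {m : ℕ} {Ω : Type*} [MeasurableSpace Ω] (P : Measure Ω)
    (θ₀ : Ω → Param d) (B : ℕ → Ω → M.Batch m) (ξ : ℕ → Ω → Param d) : Prop where
  measurable_init : Measurable θ₀
  measurable_batch : ∀ t, Measurable (B t)
  measurable_noise : ∀ t, Measurable (ξ t)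
  law : ∀ t, P.map (fun ω => (B t ω, ξ t ω))
    = (M.batchPMF m).toMeasure.prod (stdGaussian (Param d))
  iIndep : iIndepFun (fun t ω => (B t ω, ξ t ω)) P
  indep_init : IndepFun θ₀ (fun ω t => (B t ω, ξ t ω)) P

/-- The generator `L ψ = ½ ⟨∇ log π, ∇ ψ⟩ + ½ Δ ψ` of the Langevin diffusion
`dθ = ½ ∇ log π(θ) dt + dW` that leaves the posterior `π` invariant. -/
def generator (ψ : Param d → ℝ) (θ : Param d) : ℝ :=
  (1 / 2) * inner ℝ (∇ M.logPost θ) (∇ ψ θ) + (1 / 2) * Laplacian.laplacian ψ θ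

end FederatedModel

/-- The Monte Carlo average `T⁻¹ ∑_{t=1}^T φ(θ_t)`. -/
def mcAverage {Ω E : Type*} (φ : E → ℝ) (θ : ℕ → Ω → E) (T : ℕ) (ω : Ω) : ℝ :=
  (T : ℝ)⁻¹ * ∑ t ∈ Finset.Icc 1 T, φ (θ t ω)

end

/-!
By the Poisson equation, `h (φ(θ_t) - φ̄) = h L ψ(θ_t)` equals `ψ(θ_{t+1}) - ψ(θ_t)` up to a
martingale increment and the one-step bias `E[ψ(θ_{t+1}) | θ_t] - ψ(θ_t) - h L ψ(θ_t)`. The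
stochastic drift is an unbiased estimate of `½ ∇ log π`, at a bounded distance from it because all
gradients entering its noise are bounded, so a Taylor expansion in the drift and the heat equation
for the Gaussian step make the bias `O(h²)`. The martingale increments are orthogonal, with second
moments `O(h)` by the Gaussian Poincaré inequality. Telescoping, dividing by `hT` and squaring
leaves `1/(hT) + h²`.
-/

section Calculus

theorem one_add_rpow_le {x κ : ℝ} (hx : 0 ≤ x) (hκ : 0 ≤ κ) :
    (1 + x) ^ κ ≤ 2 ^ κ * (1 + x ^ κ) := by
  rcases le_total x 1 with h | h
  · calc (1 + x) ^ κ ≤ 2 ^ κ := Real.rpow_le_rpow (by positivity) (by linarith) hκ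
      _ ≤ 2 ^ κ * (1 + x ^ κ) :=
        le_mul_of_one_le_right (by positivity) (le_add_of_nonneg_right (by positivity))
  · calc (1 + x) ^ κ ≤ (2 * x) ^ κ := Real.rpow_le_rpow (by positivity) (by linarith) hκ
      _ = 2 ^ κ * x ^ κ := Real.mul_rpow (by norm_num) hx
      _ ≤ 2 ^ κ * (1 + x ^ κ) := by gcongr; linarith

theorem rpow_mul_rpow_le_add {x y a b κ : ℝ} (hx : 1 ≤ x) (hy : 1 ≤ y) (ha : 0 ≤ a) (hb : 0 ≤ b)
    (hκ : a + b ≤ κ) : x ^ a * y ^ b ≤ x ^ κ + y ^ κ := by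
  have hmax : 1 ≤ max x y := hx.trans (le_max_left _ _)
  calc x ^ a * y ^ b ≤ max x y ^ a * max x y ^ b := by
        gcongr
        · exact le_max_left _ _
        · exact le_max_right _ _
    _ = max x y ^ (a + b) := (Real.rpow_add (by linarith) _ _).symm
    _ ≤ max x y ^ κ := Real.rpow_le_rpow_of_exponent_le hmax hκ
    _ ≤ x ^ κ + y ^ κ := by
        rcases max_choice x y with h | h <;> rw [h]
        · exact le_add_of_nonneg_right (by positivity)
        · exact le_add_of_nonneg_left (by positivity)

section Normed

variable {E F : Type*} [NormedAddCommGroup E] [NormedSpace ℝ E] [NormedAddCommGroup F]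
  [NormedSpace ℝ F]

theorem norm_fderiv_fderiv (g : E → F) (x : E) :
    ‖fderiv ℝ (fderiv ℝ g) x‖ = ‖iteratedFDeriv ℝ 2 g x‖ := by
  rw [← norm_iteratedFDeriv_one, norm_iteratedFDeriv_fderiv]

theorem norm_iteratedFDeriv_two_apply_le (g : E → F) (z v w : E) :
    ‖iteratedFDeriv ℝ 2 g z ![v, w]‖ ≤ ‖iteratedFDeriv ℝ 2 g z‖ * ‖v‖ * ‖w‖ := by
  simpa only [Fin.prod_univ_two, mul_assoc, Matrix.cons_val_zero, Matrix.cons_val_one]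
    using (iteratedFDeriv ℝ 2 g z).le_opNorm ![v, w]

theorem norm_iteratedFDeriv_fderiv_apply_le {f : E → F} {n j : ℕ} (hf : ContDiff ℝ (n + 1) f)
    (hj : j ≤ n) (v x : E) :
    ‖iteratedFDeriv ℝ j (fun y => fderiv ℝ f y v) x‖ ≤ ‖v‖ * ‖iteratedFDeriv ℝ (j + 1) f x‖ := by
  rw [← norm_iteratedFDeriv_fderiv]
  exact norm_iteratedFDeriv_clm_apply_const
    (hf.fderiv_right (m := n) le_rfl).contDiffAt (by exact_mod_cast hj)

theorem hasFDerivAt_fderiv_comp_add_smul_apply {g : E → F} (hg : ContDiff ℝ 2 g) (y : E) (u : ℝ)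
    (v x : E) :
    HasFDerivAt (fun x => fderiv ℝ g (y + u • x) v)
      (u • (fderiv ℝ (fderiv ℝ g) (y + u • x)).flip v) x := by
  have hshift : HasFDerivAt (fun x : E => y + u • x) (u • ContinuousLinearMap.id ℝ E) x :=
    ((hasFDerivAt_id x).const_smul u).const_add y
  have hfderiv : Differentiable ℝ (fderiv ℝ g) :=
    (hg.fderiv_right (m := 1) (by norm_num)).differentiable (by norm_num)
  refine ((ContinuousLinearMap.apply ℝ F v).hasFDerivAt.comp x
    ((hfderiv _).hasFDerivAt.comp x hshift)).congr_fderiv ?_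
  ext w
  simp

theorem hasDerivAt_comp_add_smul {g : E → F} (hg : Differentiable ℝ g) (y x : E) (u : ℝ) :
    HasDerivAt (fun u : ℝ => g (y + u • x)) (fderiv ℝ g (y + u • x) x) u := by
  have hline : HasDerivAt (fun u : ℝ => y + u • x) x u := by
    simpa using ((hasDerivAt_id u).smul_const x).const_add y
  exact (hg _).hasFDerivAt.comp_hasDerivAt u hline

theorem norm_add_sub_le_of_norm_fderiv_mul_le {g : E → F} (hg : Differentiable ℝ g) (x v : E)
    {N : ℝ} (hN : ∀ z ∈ segment ℝ x (x + v), ‖fderiv ℝ g z‖ * ‖v‖ ≤ N) :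
    ‖g (x + v) - g x‖ ≤ N := by
  rcases eq_or_ne v 0 with rfl | hv
  · simpa using hN x (left_mem_segment ℝ _ _)
  have hv' : 0 < ‖v‖ := norm_pos_iff.2 hv
  have h := (convex_segment x (x + v)).norm_image_sub_le_of_norm_fderiv_le (𝕜 := ℝ)
    (fun z _ => hg z) (fun z hz => (le_div_iff₀ hv').2 (hN z hz))
    (left_mem_segment ℝ _ _) (right_mem_segment ℝ _ _)
  rwa [add_sub_cancel_left, div_mul_cancel₀ _ hv'.ne'] at h

theorem norm_taylor_two_le_of_norm_iteratedFDeriv_mul_le {g : E → F} (hg : ContDiff ℝ 2 g)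
    (x v : E) {N : ℝ}
    (hN : ∀ z ∈ segment ℝ x (x + v), ‖iteratedFDeriv ℝ 2 g z‖ * ‖v‖ ^ 2 ≤ N) :
    ‖g (x + v) - g x - fderiv ℝ g x v‖ ≤ N := by
  rcases eq_or_ne v 0 with rfl | hv
  · simpa using hN x (left_mem_segment ℝ _ _)
  have hv' : 0 < ‖v‖ := norm_pos_iff.2 hv
  have hN0 : 0 ≤ N := le_trans (by positivity) (hN x (left_mem_segment ℝ _ _))
  have hfderiv : Differentiable ℝ (fderiv ℝ g) :=
    (hg.fderiv_right (m := 1) (by norm_num)).differentiable (by norm_num)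
  have hseg := convex_segment (𝕜 := ℝ) x (x + v)
  have hvar : ∀ z ∈ segment ℝ x (x + v), ‖fderiv ℝ g z - fderiv ℝ g x‖ ≤ N / ‖v‖ := fun z hz =>
    calc ‖fderiv ℝ g z - fderiv ℝ g x‖ ≤ N / ‖v‖ ^ 2 * ‖z - x‖ :=
          hseg.norm_image_sub_le_of_norm_fderiv_le (𝕜 := ℝ) (fun z _ => hfderiv z)
            (fun z hz => by
              rw [norm_fderiv_fderiv, le_div_iff₀ (by positivity)]
              exact hN z hz) (left_mem_segment ℝ _ _) hz
      _ ≤ N / ‖v‖ ^ 2 * ‖v‖ := by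
          gcongr
          simpa using norm_sub_le_of_mem_segment hz
      _ = N / ‖v‖ := by field_simp
  have h := hseg.norm_image_sub_le_of_norm_fderiv_le' (𝕜 := ℝ)
    (fun z _ => (hg.differentiable (by norm_num)) z) hvar
    (left_mem_segment ℝ _ _) (right_mem_segment ℝ _ _)
  rwa [add_sub_cancel_left, div_mul_cancel₀ _ hv'.ne'] at h

theorem norm_iteratedFDeriv_two_mul_le {f g : E → ℝ} (hf : ContDiff ℝ 2 f) (hg : ContDiff ℝ 2 g)
    {x : E} {a b : ℝ} (ha : ∀ j ≤ 2, ‖iteratedFDeriv ℝ j f x‖ ≤ a)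
    (hb : ∀ j ≤ 2, ‖iteratedFDeriv ℝ j g x‖ ≤ b) :
    ‖iteratedFDeriv ℝ 2 (fun x => f x * g x) x‖ ≤ 4 * (a * b) := by
  have ha0 : 0 ≤ a := (norm_nonneg _).trans (ha 0 (by norm_num))
  calc _ ≤ ∑ j ∈ Finset.range 3, ((Nat.choose 2 j : ℕ) : ℝ) * ‖iteratedFDeriv ℝ j f x‖
          * ‖iteratedFDeriv ℝ (2 - j) g x‖ := norm_iteratedFDeriv_mul_le hf hg x le_rfl
    _ ≤ ∑ j ∈ Finset.range 3, ((Nat.choose 2 j : ℕ) : ℝ) * (a * b) := by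
        refine Finset.sum_le_sum fun j hj => ?_
        rw [mul_assoc]
        gcongr
        · exact ha j (Nat.lt_succ_iff.1 (Finset.mem_range.1 hj))
        · exact hb _ (Nat.sub_le _ _)
    _ = 4 * (a * b) := by
        simp only [← Finset.sum_mul, Finset.sum_range_succ, Finset.sum_range_zero, Nat.choose]
        norm_num

end Normed

section Gradient

variable {E : Type*} [NormedAddCommGroup E] [InnerProductSpace ℝ E] [CompleteSpace E]

theorem norm_gradient (f : E → ℝ) (x : E) : ‖∇ f x‖ = ‖fderiv ℝ f x‖ :=
  LinearIsometryEquiv.norm_map _ _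

theorem norm_gradient_le_of_lipschitzWith {f : E → ℝ} {K : NNReal} (hf : LipschitzWith K f)
    (x : E) : ‖∇ f x‖ ≤ K :=
  (norm_gradient f x).trans_le (norm_fderiv_le_of_lipschitz ℝ hf)

theorem measurable_gradient [MeasurableSpace E] [BorelSpace E] (f : E → ℝ) : Measurable (∇ f) :=
  (toDual ℝ E).symm.continuous.measurable.comp (measurable_fderiv ℝ f)

theorem hasGradientAt_sum {ι : Type*} {s : Finset ι} {f : ι → E → ℝ} {x : E}
    (hf : ∀ i ∈ s, DifferentiableAt ℝ (f i) x) :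
    HasGradientAt (fun y => ∑ i ∈ s, f i y) (∑ i ∈ s, ∇ (f i) x) x := by
  rw [hasGradientAt_iff_hasFDerivAt, map_sum]
  exact HasFDerivAt.fun_sum fun i hi => (hf i hi).hasGradientAt.hasFDerivAt

end Gradient

section Laplacian

variable {E : Type*} [NormedAddCommGroup E] [InnerProductSpace ℝ E] [FiniteDimensional ℝ E]

theorem norm_laplacian_le {F : Type*} [NormedAddCommGroup F] [NormedSpace ℝ F] (g : E → F)
    (z : E) : ‖Laplacian.laplacian g z‖ ≤ Module.finrank ℝ E * ‖iteratedFDeriv ℝ 2 g z‖ := by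
  rw [laplacian_eq_iteratedFDeriv_stdOrthonormalBasis]
  refine (norm_sum_le_of_le _ fun i _ => norm_iteratedFDeriv_two_apply_le g z _ _).trans ?_
  simp

theorem norm_fderiv_laplacian_le {F : Type*} [NormedAddCommGroup F] [NormedSpace ℝ F] {g : E → F}
    (hg : ContDiff ℝ 3 g) (x : E) :
    ‖fderiv ℝ (Laplacian.laplacian g) x‖ ≤ Module.finrank ℝ E * ‖iteratedFDeriv ℝ 3 g x‖ := by
  set eval := fun i => ContinuousMultilinearMap.apply ℝ (fun _ : Fin 2 => E) F
    ![stdOrthonormalBasis ℝ E i, stdOrthonormalBasis ℝ E i]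
  have heval : ∀ i, ‖eval i‖ ≤ 1 := fun i =>
    ContinuousLinearMap.opNorm_le_bound _ zero_le_one fun A => by
      simpa [eval, Fin.prod_univ_two]
        using A.le_opNorm ![stdOrthonormalBasis ℝ E i, stdOrthonormalBasis ℝ E i]
  have hderiv : HasFDerivAt (Laplacian.laplacian g)
      (∑ i, (eval i).comp (fderiv ℝ (iteratedFDeriv ℝ 2 g) x)) x := by
    rw [laplacian_eq_iteratedFDeriv_stdOrthonormalBasis]
    exact HasFDerivAt.fun_sum fun i _ => (eval i).hasFDerivAt.comp x
      ((hg.differentiable_iteratedFDeriv (m := 2) (by norm_num)) x).hasFDerivAt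
  rw [hderiv.fderiv]
  refine (norm_sum_le_of_le (n := fun _ => ‖iteratedFDeriv ℝ 3 g x‖) _ fun i _ => ?_).trans
    (by simp)
  calc _ ≤ ‖eval i‖ * ‖fderiv ℝ (iteratedFDeriv ℝ 2 g) x‖ := ContinuousLinearMap.opNorm_comp_le _ _
    _ ≤ ‖iteratedFDeriv ℝ 3 g x‖ := by
        rw [norm_fderiv_iteratedFDeriv]
        exact mul_le_of_le_one_left (norm_nonneg _) (heval i)

theorem inner_gradient_gradient_eq_sum (f g : E → ℝ) (x : E) :
    inner ℝ (∇ f x) (∇ g x) = ∑ i, fderiv ℝ f x (stdOrthonormalBasis ℝ E i)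
      * fderiv ℝ g x (stdOrthonormalBasis ℝ E i) := by
  rw [← (stdOrthonormalBasis ℝ E).sum_inner_mul_inner]
  exact Finset.sum_congr rfl fun i _ => by
    rw [inner_gradient_left, inner_gradient_right, conj_trivial]

theorem contDiff_inner_gradient {f g : E → ℝ} {n : WithTop ℕ∞} (hf : ContDiff ℝ (n + 1) f)
    (hg : ContDiff ℝ (n + 1) g) : ContDiff ℝ n (fun x => inner ℝ (∇ f x) (∇ g x)) := by
  simp_rw [inner_gradient_gradient_eq_sum]
  exact ContDiff.sum fun i _ => ((hf.fderiv_right le_rfl).clm_apply contDiff_const).mul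
    ((hg.fderiv_right le_rfl).clm_apply contDiff_const)

theorem norm_iteratedFDeriv_two_inner_gradient_le {f g : E → ℝ} (hf : ContDiff ℝ 3 f)
    (hg : ContDiff ℝ 3 g) {x : E} {a b : ℝ}
    (ha : ∀ j ∈ Finset.Icc 1 3, ‖iteratedFDeriv ℝ j f x‖ ≤ a)
    (hb : ∀ j ∈ Finset.Icc 1 3, ‖iteratedFDeriv ℝ j g x‖ ≤ b) :
    ‖iteratedFDeriv ℝ 2 (fun x => inner ℝ (∇ f x) (∇ g x)) x‖
      ≤ Module.finrank ℝ E * (4 * (a * b)) := by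
  set e := stdOrthonormalBasis ℝ E
  have hsmooth : ∀ {u : E → ℝ}, ContDiff ℝ 3 u → ∀ i, ContDiff ℝ 2 (fun x => fderiv ℝ u x (e i)) :=
    fun hu i => (hu.fderiv_right (m := 2) (by norm_num)).clm_apply contDiff_const
  have hbound : ∀ {u : E → ℝ} {c : ℝ}, ContDiff ℝ 3 u →
      (∀ j ∈ Finset.Icc 1 3, ‖iteratedFDeriv ℝ j u x‖ ≤ c) →
      ∀ i, ∀ j ≤ 2, ‖iteratedFDeriv ℝ j (fun x => fderiv ℝ u x (e i)) x‖ ≤ c :=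
    fun hu hc i j hj => (norm_iteratedFDeriv_fderiv_apply_le (n := 2) hu hj _ x).trans (by
      simpa using hc (j + 1) (Finset.mem_Icc.2 ⟨by omega, by omega⟩))
  simp_rw [inner_gradient_gradient_eq_sum]
  rw [iteratedFDeriv_fun_sum_apply fun i _ => ((hsmooth hf i).mul (hsmooth hg i)).contDiffAt]
  refine (norm_sum_le_of_le (n := fun _ => 4 * (a * b)) _ fun i _ => ?_).trans (by simp)
  exact norm_iteratedFDeriv_two_mul_le (hsmooth hf i) (hsmooth hg i) (hbound hf ha i)
    (hbound hg hb i)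

end Laplacian

end Calculus

section Gaussian

section Jensen

variable {Ω : Type*} [MeasurableSpace Ω] {μ : Measure Ω}

theorem sq_integral_le_integral_sq [IsProbabilityMeasure μ] {f : Ω → ℝ} (hf : MemLp f 2 μ) :
    (∫ x, f x ∂μ) ^ 2 ≤ ∫ x, f x ^ 2 ∂μ :=
  sub_nonneg.1 ((variance_nonneg f μ).trans_eq (variance_eq_sub hf))

theorem sq_lintegral_le_mul_lintegral_sq {f : Ω → ENNReal} (hf : AEMeasurable f μ) :
    (∫⁻ x, f x ∂μ) ^ 2 ≤ μ Set.univ * ∫⁻ x, f x ^ 2 ∂μ := by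
  have hholder : ∫⁻ x, f x ∂μ
      ≤ (∫⁻ x, f x ^ (2 : ℝ) ∂μ) ^ (1 / 2 : ℝ) * μ Set.univ ^ (1 / 2 : ℝ) := by
    simpa only [Pi.mul_apply, mul_one, ENNReal.one_rpow, lintegral_one] using
      ENNReal.lintegral_mul_le_Lp_mul_Lq μ Real.HolderConjugate.two_two hf
        (aemeasurable_const (b := (1 : ENNReal)))
  calc (∫⁻ x, f x ∂μ) ^ 2 ≤ ((∫⁻ x, f x ^ (2 : ℝ) ∂μ) ^ (1 / 2 : ℝ)
        * μ Set.univ ^ (1 / 2 : ℝ)) ^ 2 := by gcongr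
    _ = μ Set.univ * ∫⁻ x, f x ^ 2 ∂μ := by
      rw [mul_pow, ← ENNReal.rpow_mul_natCast, ← ENNReal.rpow_mul_natCast, mul_comm]
      norm_num

end Jensen

variable {E : Type*} [NormedAddCommGroup E] [InnerProductSpace ℝ E]

variable (E) in
/-- The normalizing constant `(2π)^(-n/2)` of the standard Gaussian density on `E`, `n = dim E`. -/
noncomputable def gaussianNormalizer : ℝ := ((2 * Real.pi) ^ (Module.finrank ℝ E / 2 : ℝ))⁻¹

/-- The standard Gaussian density on `E`, with respect to the Lebesgue measure. -/
noncomputable def gaussianDensity (x : E) : ℝ :=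
  gaussianNormalizer E * Real.exp (-(1 / 2) * ‖x‖ ^ 2)

theorem gaussianDensity_pos (x : E) : 0 < gaussianDensity x := by
  unfold gaussianDensity gaussianNormalizer
  positivity

theorem hasFDerivAt_gaussianDensity (x : E) :
    HasFDerivAt gaussianDensity (-gaussianDensity x • innerSL ℝ x) x := by
  refine ((((hasStrictFDerivAt_norm_sq x).hasFDerivAt).const_mul (-(1 / 2))).exp.const_mul
    (gaussianNormalizer E)).congr_fderiv ?_
  ext v
  simp only [gaussianDensity, smul_apply, coe_innerSL_apply, nsmul_eq_mul, smul_eq_mul]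
  ring

variable [MeasurableSpace E] [BorelSpace E]

theorem measurable_gaussianDensity : Measurable (gaussianDensity : E → ℝ) := by
  unfold gaussianDensity
  fun_prop

variable [FiniteDimensional ℝ E]

theorem integrable_exp_neg_half_sq_norm :
    Integrable (fun x : E => Real.exp (-(1 / 2) * ‖x‖ ^ 2)) := by
  refine (GaussianFourier.integrable_cexp_neg_mul_sq_norm_add (V := E)
    (b := ((1 / 2 : ℝ) : ℂ)) (by norm_num) 0 0).norm.congr (.of_forall fun x => ?_)
  simp only [Complex.norm_exp]
  congr 1
  simp [← Complex.ofReal_pow]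

theorem integral_gaussianDensity_mul_cexp (t : E) :
    ∫ x, (gaussianDensity x : ℂ) * Complex.exp (inner ℝ x t * Complex.I)
      = Complex.exp (-‖t‖ ^ 2 / 2) := by
  have hintegrand : ∀ x : E, (gaussianDensity x : ℂ) * Complex.exp (inner ℝ x t * Complex.I)
      = (gaussianNormalizer E : ℂ) *
        Complex.exp (-((1 / 2 : ℝ) : ℂ) * ‖x‖ ^ 2 + Complex.I * inner ℝ t x) := fun x => by
    rw [Complex.exp_add, gaussianDensity, real_inner_comm, mul_comm Complex.I]
    push_cast
    ring
  have hnormalizer : ((Real.pi : ℂ) / ((1 / 2 : ℝ) : ℂ)) ^ (Module.finrank ℝ E / 2 : ℂ)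
      = (((2 * Real.pi) ^ (Module.finrank ℝ E / 2 : ℝ) : ℝ) : ℂ) := by
    rw [Complex.ofReal_cpow (by positivity)]
    push_cast
    congr 1
    ring
  simp_rw [hintegrand]
  rw [integral_const_mul, GaussianFourier.integral_cexp_neg_mul_sq_norm_add (by norm_num),
    hnormalizer, ← mul_assoc, ← Complex.ofReal_mul, gaussianNormalizer,
    inv_mul_cancel₀ (by positivity), Complex.I_sq, Complex.ofReal_one, one_mul]
  congr 1
  push_cast
  ring

theorem stdGaussian_eq_withDensity :
    stdGaussian E = volume.withDensity (fun x => ENNReal.ofReal (gaussianDensity x)) := by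
  have : IsFiniteMeasure
      ((volume : Measure E).withDensity (fun x => ENNReal.ofReal (gaussianDensity x))) :=
    isFiniteMeasure_withDensity_ofReal
      (integrable_exp_neg_half_sq_norm.const_mul (gaussianNormalizer E)).2
  apply Measure.ext_of_charFun
  ext t
  rw [charFun_stdGaussian, charFun_apply, integral_withDensity_eq_integral_toReal_smul
    measurable_gaussianDensity.ennreal_ofReal (by simp), ← integral_gaussianDensity_mul_cexp]
  simp only [ENNReal.toReal_ofReal (gaussianDensity_pos _).le, Complex.real_smul]

theorem integrable_stdGaussian_iff {f : E → ℝ} :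
    Integrable f (stdGaussian E) ↔ Integrable (fun x => gaussianDensity x * f x) := by
  rw [stdGaussian_eq_withDensity, integrable_withDensity_iff_integrable_smul'
    measurable_gaussianDensity.ennreal_ofReal (by simp)]
  simp only [ENNReal.toReal_ofReal (gaussianDensity_pos _).le, smul_eq_mul]

theorem integral_stdGaussian (f : E → ℝ) :
    ∫ x, f x ∂(stdGaussian E) = ∫ x, gaussianDensity x * f x := by
  rw [stdGaussian_eq_withDensity, integral_withDensity_eq_integral_toReal_smul
    measurable_gaussianDensity.ennreal_ofReal (by simp)]
  simp only [ENNReal.toReal_ofReal (gaussianDensity_pos _).le, smul_eq_mul]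

theorem integral_mul_inner_stdGaussian {f : E → ℝ} (v : E) (hf : Differentiable ℝ f)
    (hint : Integrable f (stdGaussian E))
    (hmul : Integrable (fun x => f x * inner ℝ x v) (stdGaussian E))
    (hderiv : Integrable (fun x => fderiv ℝ f x v) (stdGaussian E)) :
    ∫ x, f x * inner ℝ x v ∂(stdGaussian E) = ∫ x, fderiv ℝ f x v ∂(stdGaussian E) := by
  have hfderiv : ∀ x : E, fderiv ℝ gaussianDensity x v * f x
      = -(gaussianDensity x * (f x * inner ℝ x v)) := fun x => by
    rw [(hasFDerivAt_gaussianDensity x).fderiv]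
    simp only [neg_smul, neg_apply, smul_apply,
      innerSL_apply_apply, smul_eq_mul]
    ring
  rw [integrable_stdGaussian_iff] at hint hmul hderiv
  rw [integral_stdGaussian, integral_stdGaussian,
    integral_mul_fderiv_eq_neg_fderiv_mul_of_integrable
    (by simp only [hfderiv]; exact hmul.neg) hderiv hint
    (fun x _ => (hasFDerivAt_gaussianDensity x).differentiableAt) (fun x _ => hf x)]
  simp only [hfderiv, integral_neg, neg_neg]

theorem integrable_mul_norm_stdGaussian {Φ : E → ℝ} (hΦ : MemLp Φ 2 (stdGaussian E)) :
    Integrable (fun x => Φ x * ‖x‖) (stdGaussian E) :=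
  hΦ.integrable_mul (IsGaussian.memLp_two_id (μ := stdGaussian E)).norm

theorem measurePreserving_neg_stdGaussian :
    MeasurePreserving (fun x : E => -x) (stdGaussian E) (stdGaussian E) :=
  ⟨measurable_neg, stdGaussian_map (LinearIsometryEquiv.neg ℝ (E := E))⟩

end Gaussian

section GaussianAverage

theorem integral_fderiv_comp_add_smul_apply {E : Type*} [NormedAddCommGroup E]
    [NormedSpace ℝ E] {g : E → ℝ} (hg : ContDiff ℝ 1 g) (y x : E)
    (a : ℝ) :
    ∫ u in (0 : ℝ)..a, fderiv ℝ g (y + u • x) x = g (y + a • x) - g y := by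
  have hcont : Continuous fun u : ℝ => fderiv ℝ g (y + u • x) x :=
    ((hg.continuous_fderiv one_ne_zero).comp (by fun_prop)).clm_apply continuous_const
  rw [intervalIntegral.integral_eq_sub_of_hasDerivAt
    (fun u _ => hasDerivAt_comp_add_smul (hg.differentiable one_ne_zero) y x u)
    (hcont.intervalIntegrable _ _), zero_smul, add_zero]

variable {E : Type*} [NormedAddCommGroup E] [InnerProductSpace ℝ E] [FiniteDimensional ℝ E]
  [MeasurableSpace E] [BorelSpace E]

/-- The average of `g` over the Gaussian measure `𝒩(y, a² I)`, i.e. the heat semigroup at time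
`a² / 2` applied to `g`. -/
noncomputable def gaussianAvg (g : E → ℝ) (a : ℝ) (y : E) : ℝ :=
  ∫ x, g (y + a • x) ∂(stdGaussian E)

theorem integral_fderiv_comp_add_smul_apply_mul_inner {g : E → ℝ} (hg : ContDiff ℝ 2 g) (y v : E)
    (u : ℝ) {Φ : E → ℝ} (hΦ : MemLp Φ 2 (stdGaussian E))
    (hD1 : ∀ x, ‖fderiv ℝ g (y + u • x)‖ ≤ Φ x)
    (hD2 : ∀ x, ‖iteratedFDeriv ℝ 2 g (y + u • x)‖ ≤ Φ x) :
    Integrable (fun x => fderiv ℝ g (y + u • x) v * inner ℝ x v) (stdGaussian E) ∧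
    Integrable (fun x => fderiv ℝ (fderiv ℝ g) (y + u • x) v v) (stdGaussian E) ∧
    ∫ x, fderiv ℝ g (y + u • x) v * inner ℝ x v ∂(stdGaussian E)
      = u * ∫ x, fderiv ℝ (fderiv ℝ g) (y + u • x) v v ∂(stdGaussian E) := by
  have hΦ_int : Integrable Φ (stdGaussian E) := hΦ.integrable (by norm_num)
  have hcont : Continuous (fun x => fderiv ℝ g (y + u • x) v) :=
    ((hg.continuous_fderiv (by norm_num)).comp (by fun_prop)).clm_apply continuous_const
  have hcont' : Continuous (fun x => fderiv ℝ (fderiv ℝ g) (y + u • x) v v) :=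
    (((hg.fderiv_right (m := 1) (by norm_num)).continuous_fderiv (by norm_num)).comp
      (by fun_prop)).clm_apply continuous_const |>.clm_apply continuous_const
  have hle : ∀ x, ‖fderiv ℝ g (y + u • x) v‖ ≤ Φ x * ‖v‖ := fun x =>
    (ContinuousLinearMap.le_opNorm _ _).trans (by gcongr; exact hD1 x)
  have hmul : Integrable (fun x => fderiv ℝ g (y + u • x) v * inner ℝ x v) (stdGaussian E) := by
    refine ((integrable_mul_norm_stdGaussian hΦ).mul_const (‖v‖ * ‖v‖)).mono' (by fun_prop)
      (.of_forall fun x => ?_)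
    rw [norm_mul, show Φ x * ‖x‖ * (‖v‖ * ‖v‖) = Φ x * ‖v‖ * (‖x‖ * ‖v‖) by ring]
    exact mul_le_mul (hle x) (norm_inner_le_norm x v) (norm_nonneg _)
      ((norm_nonneg _).trans (hle x))
  have hderiv : Integrable (fun x => fderiv ℝ (fderiv ℝ g) (y + u • x) v v) (stdGaussian E) := by
    refine (hΦ_int.mul_const (‖v‖ * ‖v‖)).mono' hcont'.aestronglyMeasurable
      (.of_forall fun x => ?_)
    refine (ContinuousLinearMap.le_opNorm₂ _ _ _).trans ?_
    rw [norm_fderiv_fderiv, mul_assoc]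
    gcongr
    exact hD2 x
  have hfderiv : ∀ x, fderiv ℝ (fun x => fderiv ℝ g (y + u • x) v) x v
      = u * fderiv ℝ (fderiv ℝ g) (y + u • x) v v := fun x => by
    rw [(hasFDerivAt_fderiv_comp_add_smul_apply hg y u v x).fderiv]
    rfl
  refine ⟨hmul, hderiv, ?_⟩
  rw [integral_mul_inner_stdGaussian v
    (fun x => (hasFDerivAt_fderiv_comp_add_smul_apply hg y u v x).differentiableAt)
    ((hΦ_int.mul_const ‖v‖).mono' hcont.aestronglyMeasurable (.of_forall hle)) hmul
    (by simpa only [hfderiv] using hderiv.const_mul u)]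
  simp only [hfderiv, integral_const_mul]

theorem integral_fderiv_comp_add_smul_apply_self {g : E → ℝ} (hg : ContDiff ℝ 2 g) (y : E)
    (u : ℝ) {Φ : E → ℝ} (hΦ : MemLp Φ 2 (stdGaussian E))
    (hD1 : ∀ x, ‖fderiv ℝ g (y + u • x)‖ ≤ Φ x)
    (hD2 : ∀ x, ‖iteratedFDeriv ℝ 2 g (y + u • x)‖ ≤ Φ x) :
    ∫ x, fderiv ℝ g (y + u • x) x ∂(stdGaussian E)
      = u * gaussianAvg (Laplacian.laplacian g) u y := by
  set b := stdOrthonormalBasis ℝ E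
  have hexpand : ∀ x, fderiv ℝ g (y + u • x) x
      = ∑ i, fderiv ℝ g (y + u • x) (b i) * inner ℝ x (b i) := fun x => by
    conv_lhs => enter [2]; rw [← b.sum_repr' x]
    simp only [map_sum, map_smul, smul_eq_mul, real_inner_comm, mul_comm]
  have hlaplacian : ∀ x, Laplacian.laplacian g (y + u • x)
      = ∑ i, fderiv ℝ (fderiv ℝ g) (y + u • x) (b i) (b i) := fun x => by
    simp only [InnerProductSpace.laplacian_eq_iteratedFDeriv_stdOrthonormalBasis,
      iteratedFDeriv_two_apply, Matrix.cons_val_zero, Matrix.cons_val_one, b]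
  have hstein := fun i => integral_fderiv_comp_add_smul_apply_mul_inner hg y (b i) u hΦ hD1 hD2
  unfold gaussianAvg
  simp only [hexpand, hlaplacian]
  rw [integral_finsetSum _ fun i _ => (hstein i).1, integral_finsetSum _ fun i _ => (hstein i).2.1,
    Finset.mul_sum]
  exact Finset.sum_congr rfl fun i _ => (hstein i).2.2

theorem integrable_uncurry_fderiv_comp_add_smul {g : E → ℝ} (hg : ContDiff ℝ 1 g) (y : E) {a : ℝ}
    {Φ : E → ℝ} (hΦ : MemLp Φ 2 (stdGaussian E))
    (hD1 : ∀ u ∈ Set.Icc 0 a, ∀ x, ‖fderiv ℝ g (y + u • x)‖ ≤ Φ x) :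
    Integrable (Function.uncurry fun (u : ℝ) (x : E) => fderiv ℝ g (y + u • x) x)
      ((volume.restrict (Set.Ioc 0 a)).prod (stdGaussian E)) := by
  have hcont : Continuous (fun q : ℝ × E => fderiv ℝ g (y + q.1 • q.2) q.2) :=
    ((hg.continuous_fderiv one_ne_zero).comp
      (by fun_prop : Continuous fun q : ℝ × E => y + q.1 • q.2)).clm_apply continuous_snd
  refine ((integrable_mul_norm_stdGaussian hΦ).comp_snd (volume.restrict (Set.Ioc 0 a))).mono'
    hcont.aestronglyMeasurable ?_
  have hfst : ∀ᵐ q ∂((volume.restrict (Set.Ioc 0 a)).prod (stdGaussian E)), q.1 ∈ Set.Ioc 0 a :=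
    Measure.quasiMeasurePreserving_fst.ae (ae_restrict_mem measurableSet_Ioc)
  filter_upwards [hfst] with q hq
  refine (ContinuousLinearMap.le_opNorm _ _).trans ?_
  gcongr
  exact hD1 _ (Set.Ioc_subset_Icc_self hq) _

theorem integrable_comp_add_smul_stdGaussian {g : E → ℝ} (hg : ContDiff ℝ 1 g) (y : E) {a : ℝ}
    (ha : 0 ≤ a) {Φ : E → ℝ} (hΦ : MemLp Φ 2 (stdGaussian E))
    (hD1 : ∀ u ∈ Set.Icc 0 a, ∀ x, ‖fderiv ℝ g (y + u • x)‖ ≤ Φ x) :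
    Integrable (fun x => g (y + a • x)) (stdGaussian E) := by
  have hsub : Integrable (fun x => g (y + a • x) - g y) (stdGaussian E) := by
    simp only [← integral_fderiv_comp_add_smul_apply hg, intervalIntegral.integral_of_le ha]
    exact (integrable_uncurry_fderiv_comp_add_smul hg y hΦ hD1).integral_prod_right
  exact (hsub.add (integrable_const (g y))).congr (.of_forall fun x => sub_add_cancel _ _)

section HeatEquation

variable {g : E → ℝ} (hg : ContDiff ℝ 2 g) (y : E) {a : ℝ} (ha : 0 ≤ a) {Φ : E → ℝ}
  (hΦ : MemLp Φ 2 (stdGaussian E))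
  (hD1 : ∀ u ∈ Set.Icc 0 a, ∀ x, ‖fderiv ℝ g (y + u • x)‖ ≤ Φ x)
  (hD2 : ∀ u ∈ Set.Icc 0 a, ∀ x, ‖iteratedFDeriv ℝ 2 g (y + u • x)‖ ≤ Φ x)

include hg ha hΦ hD1 hD2

theorem intervalIntegrable_gaussianAvg_laplacian :
    IntervalIntegrable (fun u => u * gaussianAvg (Laplacian.laplacian g) u y) volume 0 a := by
  rw [intervalIntegrable_iff_integrableOn_Ioc_of_le ha]
  refine (integrable_uncurry_fderiv_comp_add_smul (hg.of_le one_le_two) y hΦ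
    hD1).integral_prod_left.congr ?_
  filter_upwards [ae_restrict_mem measurableSet_Ioc] with u hu
  exact integral_fderiv_comp_add_smul_apply_self hg y u hΦ
    (hD1 u (Set.Ioc_subset_Icc_self hu)) (hD2 u (Set.Ioc_subset_Icc_self hu))

theorem gaussianAvg_eq_add_integral_laplacian :
    gaussianAvg g a y
      = g y + ∫ u in (0 : ℝ)..a, u * gaussianAvg (Laplacian.laplacian g) u y := by
  have hg1 : ContDiff ℝ 1 g := hg.of_le one_le_two
  have hsub : ∫ x, (g (y + a • x) - g y) ∂(stdGaussian E)
      = ∫ u in (0 : ℝ)..a, u * gaussianAvg (Laplacian.laplacian g) u y := by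
    simp only [← integral_fderiv_comp_add_smul_apply hg1, intervalIntegral.integral_of_le ha]
    rw [← integral_integral_swap (integrable_uncurry_fderiv_comp_add_smul hg1 y hΦ hD1)]
    exact setIntegral_congr_fun measurableSet_Ioc fun u hu =>
      integral_fderiv_comp_add_smul_apply_self hg y u hΦ
        (hD1 u (Set.Ioc_subset_Icc_self hu)) (hD2 u (Set.Ioc_subset_Icc_self hu))
  rw [integral_sub (integrable_comp_add_smul_stdGaussian hg1 y ha hΦ hD1) (integrable_const _),
    integral_const, probReal_univ, one_smul] at hsub
  exact sub_eq_iff_eq_add'.1 hsub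

end HeatEquation

end GaussianAverage

section Poincare

/-- A (non-optimal) constant in the Poincaré inequality for the standard Gaussian measure. -/
noncomputable def gaussianPoincareConst (E : Type*) [NormedAddCommGroup E] [InnerProductSpace ℝ E]
    [FiniteDimensional ℝ E] [MeasurableSpace E] : ENNReal :=
  ENNReal.ofReal (Real.pi / 2) ^ 2 * ∫⁻ x, ‖x‖ₑ ^ 2 ∂(stdGaussian E)

theorem sq_enorm_sub_le_lintegral_rotation {E : Type*} [NormedAddCommGroup E] [NormedSpace ℝ E]
    {f : E → ℝ} (hf : ContDiff ℝ 1 f) (q : E × E) :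
    ‖f q.1 - f q.2‖ₑ ^ 2 ≤ ENNReal.ofReal (Real.pi / 2) * ∫⁻ t in Set.Ioc 0 (Real.pi / 2),
      ‖fderiv ℝ f (ContinuousLinearMap.rotation t q).1
        (ContinuousLinearMap.rotation t q).2‖ₑ ^ 2 := by
  have hderiv : ∀ t : ℝ, HasDerivAt (fun t : ℝ => f (Real.cos t • q.1 + Real.sin t • q.2))
      (fderiv ℝ f (ContinuousLinearMap.rotation t q).1
        (ContinuousLinearMap.rotation t q).2) t := fun t => by
    simp only [ContinuousLinearMap.rotation_apply]
    exact (hf.differentiable one_ne_zero _).hasFDerivAt.comp_hasDerivAt t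
      (((Real.hasDerivAt_cos t).smul_const _).add ((Real.hasDerivAt_sin t).smul_const _))
  have hcont : Continuous fun t : ℝ => fderiv ℝ f (ContinuousLinearMap.rotation t q).1
      (ContinuousLinearMap.rotation t q).2 := by
    simp only [ContinuousLinearMap.rotation_apply]
    exact ((hf.continuous_fderiv one_ne_zero).comp (by fun_prop)).clm_apply (by fun_prop)
  have hftc := intervalIntegral.integral_eq_sub_of_hasDerivAt (a := 0) (b := Real.pi / 2)
    (fun t _ => hderiv t) (hcont.intervalIntegrable _ _)
  rw [intervalIntegral.integral_of_le (by positivity)] at hftc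
  simp only [Real.cos_pi_div_two, Real.sin_pi_div_two, Real.cos_zero, Real.sin_zero, zero_smul,
    one_smul, zero_add, add_zero] at hftc
  rw [enorm_sub_rev, ← hftc]
  refine (pow_le_pow_left₀ zero_le (enorm_integral_le_lintegral_enorm _) 2).trans
    ((sq_lintegral_le_mul_lintegral_sq hcont.enorm.measurable.aemeasurable).trans_eq ?_)
  rw [Measure.restrict_apply_univ, Real.volume_Ioc, sub_zero]

variable {E : Type*} [NormedAddCommGroup E] [InnerProductSpace ℝ E] [FiniteDimensional ℝ E]
  [MeasurableSpace E] [BorelSpace E]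

theorem gaussianPoincareConst_ne_top : gaussianPoincareConst E ≠ ⊤ := by
  refine ENNReal.mul_ne_top (by simp) ?_
  have hnorm := (IsGaussian.memLp_two_id (μ := stdGaussian E)).eLpNorm_lt_top
  rw [eLpNorm_lt_top_iff_lintegral_rpow_enorm_lt_top (by norm_num) (by norm_num)] at hnorm
  simpa using hnorm.ne

-- The quarter turn from `q.1` to `q.2` preserves the product measure, so position and velocity
-- along it stay independent standard Gaussians.
theorem lintegral_sub_sq_stdGaussian_le {f : E → ℝ} (hf : ContDiff ℝ 1 f) :
    ∫⁻ q, ‖f q.1 - f q.2‖ₑ ^ 2 ∂((stdGaussian E).prod (stdGaussian E))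
      ≤ gaussianPoincareConst E * ∫⁻ x, ‖fderiv ℝ f x‖ₑ ^ 2 ∂(stdGaussian E) := by
  set γ := stdGaussian E
  have hcont : Continuous (fderiv ℝ f) := hf.continuous_fderiv one_ne_zero
  let F : E × E → ENNReal := fun q => ‖fderiv ℝ f q.1 q.2‖ₑ ^ 2
  have hF : Measurable F :=
    ((hcont.comp continuous_fst).clm_apply continuous_snd).enorm.measurable.pow_const 2
  have hrotation : Continuous fun r : ℝ × (E × E) => ContinuousLinearMap.rotation r.1 r.2 := by
    simp only [ContinuousLinearMap.rotation_apply]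
    fun_prop
  have hinvariant : ∀ t : ℝ, ∫⁻ q, F (ContinuousLinearMap.rotation t q) ∂(γ.prod γ)
      = ∫⁻ q, F q ∂(γ.prod γ) := fun t => by
    conv_rhs => rw [← IsGaussian.map_rotation_eq_self_of_forall_strongDual_eq_zero
      (μ := γ) integral_strongDual_stdGaussian t]
    rw [lintegral_map hF (ContinuousLinearMap.continuous _).measurable]
  calc ∫⁻ q, ‖f q.1 - f q.2‖ₑ ^ 2 ∂(γ.prod γ)
      ≤ ∫⁻ q, ENNReal.ofReal (Real.pi / 2)
          * (∫⁻ t in Set.Ioc 0 (Real.pi / 2), F (ContinuousLinearMap.rotation t q)) ∂(γ.prod γ) :=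
        lintegral_mono (sq_enorm_sub_le_lintegral_rotation hf)
    _ = ENNReal.ofReal (Real.pi / 2) * ∫⁻ t in Set.Ioc 0 (Real.pi / 2),
          ∫⁻ q, F (ContinuousLinearMap.rotation t q) ∂(γ.prod γ) := by
        rw [lintegral_const_mul' _ _ ENNReal.ofReal_ne_top, lintegral_lintegral_swap]
        exact (hF.comp (hrotation.measurable.comp measurable_swap)).aemeasurable
    _ = ENNReal.ofReal (Real.pi / 2) ^ 2 * ∫⁻ q, F q ∂(γ.prod γ) := by
        simp_rw [hinvariant]
        rw [lintegral_const, Measure.restrict_apply_univ, Real.volume_Ioc, sub_zero]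
        ring
    _ ≤ ENNReal.ofReal (Real.pi / 2) ^ 2
          * ∫⁻ q, ‖fderiv ℝ f q.1‖ₑ ^ 2 * ‖q.2‖ₑ ^ 2 ∂(γ.prod γ) := by
        gcongr with q
        rw [← mul_pow]
        exact pow_le_pow_left₀ zero_le (ContinuousLinearMap.le_opENorm _ _) 2
    _ = gaussianPoincareConst E * ∫⁻ x, ‖fderiv ℝ f x‖ₑ ^ 2 ∂γ := by
        rw [lintegral_prod_mul (hcont.enorm.measurable.pow_const 2).aemeasurable
          (measurable_enorm.pow_const 2).aemeasurable, gaussianPoincareConst]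
        ring

theorem evariance_stdGaussian_le {f : E → ℝ} (hf : ContDiff ℝ 1 f)
    (hint : Integrable f (stdGaussian E)) :
    evariance f (stdGaussian E)
      ≤ gaussianPoincareConst E * ∫⁻ x, ‖fderiv ℝ f x‖ₑ ^ 2 ∂(stdGaussian E) := by
  refine le_trans ?_ (lintegral_sub_sq_stdGaussian_le hf)
  have hcont := hf.continuous
  rw [lintegral_prod _ (by fun_prop)]
  refine lintegral_mono fun x => ?_
  have hcenter : f x - ∫ z, f z ∂(stdGaussian E) = ∫ z, (f x - f z) ∂(stdGaussian E) := by
    rw [integral_sub (integrable_const _) hint, integral_const, probReal_univ, one_smul]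
  rw [hcenter]
  refine (pow_le_pow_left₀ zero_le (enorm_integral_le_lintegral_enorm _) 2).trans
    ((sq_lintegral_le_mul_lintegral_sq (by fun_prop)).trans_eq ?_)
  rw [measure_univ, one_mul]

theorem variance_stdGaussian_le {f : E → ℝ} (hf : ContDiff ℝ 1 f)
    (hint : Integrable f (stdGaussian E)) {B : E → ℝ} (hB : Integrable B (stdGaussian E))
    (hfB : ∀ x, ‖fderiv ℝ f x‖ ^ 2 ≤ B x) :
    MemLp f 2 (stdGaussian E) ∧
      Var[f; stdGaussian E] ≤ (gaussianPoincareConst E).toReal * ∫ x, B x ∂(stdGaussian E) := by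
  have hB0 : ∀ x, 0 ≤ B x := fun x => (sq_nonneg _).trans (hfB x)
  have hle : evariance f (stdGaussian E)
      ≤ gaussianPoincareConst E * ENNReal.ofReal (∫ x, B x ∂(stdGaussian E)) := by
    refine (evariance_stdGaussian_le hf hint).trans ?_
    rw [ofReal_integral_eq_lintegral_ofReal hB (.of_forall hB0)]
    gcongr with x
    rw [← ofReal_norm, ← ENNReal.ofReal_pow (norm_nonneg _)]
    exact ENNReal.ofReal_le_ofReal (hfB x)
  have hfinite : gaussianPoincareConst E * ENNReal.ofReal (∫ x, B x ∂(stdGaussian E)) ≠ ⊤ :=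
    ENNReal.mul_ne_top gaussianPoincareConst_ne_top ENNReal.ofReal_ne_top
  refine ⟨(evariance_lt_top_iff_memLp hint.aestronglyMeasurable).1 (hle.trans_lt hfinite.lt_top),
    (ENNReal.toReal_mono hfinite hle).trans_eq ?_⟩
  rw [ENNReal.toReal_mul, ENNReal.toReal_ofReal (integral_nonneg hB0)]

end Poincare

section Weight

section

variable {E : Type*} [NormedAddCommGroup E] [NormedSpace ℝ E]

/-- The first two derivatives of the `C²` function `g` are dominated by the weight `w`. -/
structure HasDominatedDerivs (w : E → ℝ) (c : ℝ) (g : E → ℝ) : Prop where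
  contDiff : ContDiff ℝ 2 g
  norm_fderiv_le : ∀ x, ‖fderiv ℝ g x‖ ≤ c * w x
  norm_iteratedFDeriv_le : ∀ x, ‖iteratedFDeriv ℝ 2 g x‖ ≤ c * w x

theorem HasDominatedDerivs.mono {w : E → ℝ} {c d : ℝ} {g : E → ℝ}
    (hg : HasDominatedDerivs w c g) (hw : ∀ x, 0 ≤ w x) (hcd : c ≤ d) :
    HasDominatedDerivs w d g where
  contDiff := hg.contDiff
  norm_fderiv_le x := (hg.norm_fderiv_le x).trans (mul_le_mul_of_nonneg_right hcd (hw x))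
  norm_iteratedFDeriv_le x :=
    (hg.norm_iteratedFDeriv_le x).trans (mul_le_mul_of_nonneg_right hcd (hw x))

variable [MeasurableSpace E]

/-- A measurable weight `w ≥ 1` whose values on a segment are controlled, up to the factor `K`, by
its values at the end points. -/
structure IsWeight (w : E → ℝ) (K : ℝ) : Prop where
  measurable : Measurable w
  one_le : ∀ x, 1 ≤ w x
  segment : ∀ x y, ∀ u ∈ Set.Icc (0 : ℝ) 1, w (u • x + (1 - u) • y) ≤ K * (w x + w y)

namespace IsWeight

variable {w : E → ℝ} {K : ℝ}

theorem nonneg (hw : IsWeight w K) (x : E) : 0 ≤ w x :=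
  zero_le_one.trans (hw.one_le x)

theorem le_of_mem_segment (hw : IsWeight w K) {x y z : E} (hz : z ∈ _root_.segment ℝ x y) :
    w z ≤ K * (w x + w y) := by
  obtain ⟨a, b, ha, hb, hab, rfl⟩ := hz
  obtain rfl : b = 1 - a := eq_sub_of_add_eq' hab
  exact hw.segment x y a ⟨ha, sub_nonneg.1 hb⟩

theorem const_nonneg (hw : IsWeight w K) : 0 ≤ K := by
  have hzero := hw.le_of_mem_segment (left_mem_segment ℝ (0 : E) 0)
  nlinarith [hw.one_le (0 : E)]

theorem add_smul_le (hw : IsWeight w K) (y x : E) {a u : ℝ} (hu : u ∈ Set.Icc 0 a) :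
    w (y + u • x) ≤ K * (w (y + a • x) + w y) := by
  rw [add_comm (w _)]
  refine hw.le_of_mem_segment (mem_segment_iff_sameRay.2 ?_)
  rw [add_sub_cancel_left, add_sub_add_left_eq_sub, ← sub_smul]
  exact (SameRay.sameRay_nonneg_smul_left x hu.1).nonneg_smul_right (sub_nonneg.2 hu.2)

end IsWeight

theorem HasDominatedDerivs.const_nonneg {w : E → ℝ} {K c : ℝ} {g : E → ℝ}
    (hg : HasDominatedDerivs w c g) (hw : IsWeight w K) : 0 ≤ c :=
  nonneg_of_mul_nonneg_left ((norm_nonneg _).trans (hg.norm_fderiv_le 0))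
    (zero_lt_one.trans_le (hw.one_le 0))

end

variable {E : Type*} [NormedAddCommGroup E] [InnerProductSpace ℝ E] [FiniteDimensional ℝ E]

/-- `ψ`, its Laplacian, and the first two derivatives of both are dominated by the weight `w`. -/
structure IsDominated (w : E → ℝ) (c : ℝ) (ψ : E → ℝ) : Prop where
  abs_le : ∀ x, |ψ x| ≤ c * w x
  derivs : HasDominatedDerivs w c ψ
  derivs_laplacian : HasDominatedDerivs w c (Laplacian.laplacian ψ)

theorem IsDominated.mono {w : E → ℝ} {c d : ℝ} {ψ : E → ℝ} (hψ : IsDominated w c ψ)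
    (hw : ∀ x, 0 ≤ w x) (hcd : c ≤ d) : IsDominated w d ψ where
  abs_le x := (hψ.abs_le x).trans (mul_le_mul_of_nonneg_right hcd (hw x))
  derivs := hψ.derivs.mono hw hcd
  derivs_laplacian := hψ.derivs_laplacian.mono hw hcd

/-- The products of derivatives of `ψ` with a drift vector `G` at `x` that occur in the expansion
of `ψ` along the drift are dominated by the weight `w`. -/
structure IsDriftDominated (w : E → ℝ) (c : ℝ) (ψ : E → ℝ) (x G : E) : Prop where
  fderiv_mul_le : ∀ z, ‖fderiv ℝ ψ z‖ * ‖G‖ ≤ c * (w z + w x)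
  iteratedFDeriv_mul_le : ∀ z, ‖iteratedFDeriv ℝ 2 ψ z‖ * ‖G‖ ^ 2 ≤ c * (w z + w x)
  fderiv_laplacian_mul_le : ∀ z, ‖fderiv ℝ (Laplacian.laplacian ψ) z‖ * ‖G‖ ≤ c * (w z + w x)

namespace IsDriftDominated

variable {w : E → ℝ} {c h Q : ℝ} {ψ : E → ℝ} {x G : E}

theorem mono {d : ℝ} (hG : IsDriftDominated w c ψ x G) (hw : ∀ x, 0 ≤ w x) (hcd : c ≤ d) :
    IsDriftDominated w d ψ x G where
  fderiv_mul_le z :=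
    (hG.fderiv_mul_le z).trans (mul_le_mul_of_nonneg_right hcd (add_nonneg (hw z) (hw x)))
  iteratedFDeriv_mul_le z :=
    (hG.iteratedFDeriv_mul_le z).trans (mul_le_mul_of_nonneg_right hcd (add_nonneg (hw z) (hw x)))
  fderiv_laplacian_mul_le z :=
    (hG.fderiv_laplacian_mul_le z).trans
      (mul_le_mul_of_nonneg_right hcd (add_nonneg (hw z) (hw x)))

theorem abs_sub_le (hG : IsDriftDominated w c ψ x G) (hψ : Differentiable ℝ ψ) (hh : 0 ≤ h)
    (hQ : ∀ z ∈ segment ℝ x (x + (h / 2) • G), c * (w z + w x) ≤ Q) :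
    |ψ (x + (h / 2) • G) - ψ x| ≤ h / 2 * Q := by
  refine norm_add_sub_le_of_norm_fderiv_mul_le hψ x _ fun z hz => ?_
  rw [norm_smul, Real.norm_of_nonneg (by positivity), mul_left_comm]
  gcongr
  exact (hG.fderiv_mul_le z).trans (hQ z hz)

theorem abs_laplacian_sub_le (hG : IsDriftDominated w c ψ x G)
    (hψ : Differentiable ℝ (Laplacian.laplacian ψ)) (hh : 0 ≤ h)
    (hQ : ∀ z ∈ segment ℝ x (x + (h / 2) • G), c * (w z + w x) ≤ Q) :
    |Laplacian.laplacian ψ (x + (h / 2) • G) - Laplacian.laplacian ψ x| ≤ h / 2 * Q := by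
  refine norm_add_sub_le_of_norm_fderiv_mul_le hψ x _ fun z hz => ?_
  rw [norm_smul, Real.norm_of_nonneg (by positivity), mul_left_comm]
  gcongr
  exact (hG.fderiv_laplacian_mul_le z).trans (hQ z hz)

theorem abs_taylor_two_le (hG : IsDriftDominated w c ψ x G) (hψ : ContDiff ℝ 2 ψ) (hh : 0 ≤ h)
    (hQ : ∀ z ∈ segment ℝ x (x + (h / 2) • G), c * (w z + w x) ≤ Q) :
    |ψ (x + (h / 2) • G) - ψ x - h / 2 * fderiv ℝ ψ x G| ≤ (h / 2) ^ 2 * Q := by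
  rw [← smul_eq_mul (h / 2), ← map_smul]
  refine norm_taylor_two_le_of_norm_iteratedFDeriv_mul_le hψ x _ fun z hz => ?_
  rw [norm_smul, Real.norm_of_nonneg (by positivity), mul_pow, mul_left_comm]
  gcongr
  exact (hG.iteratedFDeriv_mul_le z).trans (hQ z hz)

end IsDriftDominated

variable [MeasurableSpace E]

theorem IsWeight.gaussianAvg_nonneg {w : E → ℝ} {K : ℝ} (hw : IsWeight w K) (a : ℝ) (y : E) :
    0 ≤ gaussianAvg w a y :=
  integral_nonneg fun _ => hw.nonneg _

variable [BorelSpace E]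

namespace IsWeight

variable {w : E → ℝ} {K : ℝ} (hw : IsWeight w K)

include hw

theorem le_two_mul_gaussianAvg (y : E) (a : ℝ)
    (hint : Integrable (fun x => w (y + a • x)) (stdGaussian E)) :
    w y ≤ 2 * K * gaussianAvg w a y := by
  have hneg : Integrable (fun x => w (y + a • -x)) (stdGaussian E) :=
    measurePreserving_neg_stdGaussian.integrable_comp_of_integrable hint
  have hneg_eq : ∫ x, w (y + a • -x) ∂(stdGaussian E) = gaussianAvg w a y :=
    measurePreserving_neg_stdGaussian.integral_comp (MeasurableEquiv.neg E).measurableEmbedding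
      (fun x => w (y + a • x))
  -- `y` is the midpoint of `y + a • x` and `y - a • x`, which have the same law.
  have hmidpoint : ∀ x, w y ≤ K * (w (y + a • x) + w (y + a • -x)) := fun x => by
    convert hw.segment (y + a • x) (y + a • -x) (1 / 2) (by norm_num) using 2
    module
  calc w y = ∫ _, w y ∂(stdGaussian E) := by rw [integral_const, probReal_univ, one_smul]
    _ ≤ ∫ x, K * (w (y + a • x) + w (y + a • -x)) ∂(stdGaussian E) :=
        integral_mono (integrable_const _) ((hint.add hneg).const_mul K) hmidpoint
    _ = 2 * K * gaussianAvg w a y := by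
        rw [integral_const_mul, integral_add hint hneg, hneg_eq, gaussianAvg]
        ring

theorem integrable_comp_add_smul (y : E) {a u : ℝ} (hu : u ∈ Set.Icc 0 a)
    (hint : Integrable (fun x => w (y + a • x)) (stdGaussian E)) :
    Integrable (fun x => w (y + u • x)) (stdGaussian E) := by
  refine ((hint.add (integrable_const (w y))).const_mul K).mono'
    (hw.measurable.comp (by fun_prop)).aestronglyMeasurable (.of_forall fun x => ?_)
  rw [Real.norm_of_nonneg (hw.nonneg _)]
  exact hw.add_smul_le y x hu

theorem gaussianAvg_le_of_mem_Icc (y : E) {a u : ℝ} (hu : u ∈ Set.Icc 0 a)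
    (hint : Integrable (fun x => w (y + a • x)) (stdGaussian E)) :
    gaussianAvg w u y ≤ (1 + K) * (1 + 2 * K) * gaussianAvg w a y := by
  have hmono := integral_mono (hw.integrable_comp_add_smul y hu hint)
    ((hint.add (integrable_const (w y))).const_mul K) fun x => hw.add_smul_le y x hu
  simp only [Pi.add_apply] at hmono
  rw [integral_const_mul, integral_add hint (integrable_const _), integral_const, probReal_univ,
    one_smul] at hmono
  refine hmono.trans ?_
  change K * (gaussianAvg w a y + w y) ≤ _
  have hK := hw.const_nonneg
  have havg := hw.gaussianAvg_nonneg a y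
  nlinarith [mul_le_mul_of_nonneg_left (hw.le_two_mul_gaussianAvg y a hint) hK]

theorem add_le_of_mem_segment {x y z : E} (hz : z ∈ _root_.segment ℝ x y) (a : ℝ)
    (hint : Integrable (fun x => w (y + a • x)) (stdGaussian E)) :
    w z + w x ≤ (1 + K) * (1 + 2 * K) * (w x + gaussianAvg w a y) := by
  have hK := hw.const_nonneg
  have hx := hw.nonneg x
  have havg := hw.gaussianAvg_nonneg a y
  calc w z + w x ≤ K * (w x + 2 * K * gaussianAvg w a y) + w x := by
        grw [hw.le_of_mem_segment hz, hw.le_two_mul_gaussianAvg y a hint]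
    _ ≤ (1 + K) * (1 + 2 * K) * (w x + gaussianAvg w a y) := by
        nlinarith [mul_nonneg hK hx, mul_nonneg hK havg, mul_nonneg hK (mul_nonneg hK hx)]

end IsWeight

section GaussianExpansion

theorem abs_integral_mul_le {f : ℝ → ℝ} {a B : ℝ} (ha : 0 ≤ a)
    (hf : ∀ v ∈ Set.Icc 0 a, |f v| ≤ B) : |∫ v in (0 : ℝ)..a, v * f v| ≤ a ^ 2 * B := by
  have hbound := intervalIntegral.norm_integral_le_of_norm_le_const (a := 0) (b := a)
    (C := a * B) (f := fun v => v * f v) fun v hv => by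
      rw [Set.uIoc_of_le ha] at hv
      rw [norm_mul, Real.norm_of_nonneg hv.1.le]
      exact mul_le_mul hv.2 (hf v (Set.Ioc_subset_Icc_self hv)) (norm_nonneg _) ha
  rw [sub_zero, abs_of_nonneg ha] at hbound
  exact hbound.trans_eq (by ring)

variable {w : E → ℝ} {K : ℝ} (hw : IsWeight w K) {c : ℝ}

namespace HasDominatedDerivs

variable {g : E → ℝ} (hg : HasDominatedDerivs w c g) (y : E) {a : ℝ}
  (hint : MemLp (fun x => w (y + a • x)) 2 (stdGaussian E))

include hw hg hint

theorem exists_majorant : ∃ Φ : E → ℝ, MemLp Φ 2 (stdGaussian E) ∧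
    (∀ u ∈ Set.Icc 0 a, ∀ x, ‖fderiv ℝ g (y + u • x)‖ ≤ Φ x) ∧
    ∀ u ∈ Set.Icc 0 a, ∀ x, ‖iteratedFDeriv ℝ 2 g (y + u • x)‖ ≤ Φ x := by
  have hle : ∀ u ∈ Set.Icc 0 a, ∀ x, c * w (y + u • x) ≤ c * (K * (w (y + a • x) + w y)) :=
    fun u hu x => mul_le_mul_of_nonneg_left (hw.add_smul_le y x hu) (hg.const_nonneg hw)
  exact ⟨fun x => c * (K * (w (y + a • x) + w y)),
    ((hint.add (memLp_const (w y))).const_mul K).const_mul c,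
    fun u hu x => (hg.norm_fderiv_le _).trans (hle u hu x),
    fun u hu x => (hg.norm_iteratedFDeriv_le _).trans (hle u hu x)⟩

theorem abs_gaussianAvg_laplacian_le {u : ℝ} (hu : u ∈ Set.Icc 0 a) :
    |gaussianAvg (Laplacian.laplacian g) u y| ≤ Module.finrank ℝ E
      * (c * ((1 + K) * (1 + 2 * K) * gaussianAvg w a y)) := by
  have hw_int : Integrable (fun x => w (y + a • x)) (stdGaussian E) :=
    hint.integrable one_le_two
  have hle : ∀ x, ‖Laplacian.laplacian g (y + u • x)‖
      ≤ Module.finrank ℝ E * (c * w (y + u • x)) := fun x =>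
    (norm_laplacian_le _ _).trans (by gcongr; exact hg.norm_iteratedFDeriv_le _)
  refine (norm_integral_le_of_norm_le (((hw.integrable_comp_add_smul y hu hw_int).const_mul
    c).const_mul _) (.of_forall hle)).trans ?_
  rw [integral_const_mul, integral_const_mul]
  exact mul_le_mul_of_nonneg_left (mul_le_mul_of_nonneg_left
    (hw.gaussianAvg_le_of_mem_Icc y hu hw_int) (hg.const_nonneg hw)) (Nat.cast_nonneg _)

theorem abs_gaussianAvg_sub_le {u : ℝ} (hu : u ∈ Set.Icc 0 a) :
    |gaussianAvg g u y - g y| ≤ a ^ 2 * (Module.finrank ℝ E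
      * (c * ((1 + K) * (1 + 2 * K) * gaussianAvg w a y))) := by
  obtain ⟨Φ, hΦ, hD1, hD2⟩ := exists_majorant hw hg y hint
  have hsub : Set.Icc 0 u ⊆ Set.Icc 0 a := Set.Icc_subset_Icc_right hu.2
  have hbound := abs_integral_mul_le hu.1 fun v hv =>
    abs_gaussianAvg_laplacian_le hw hg y hint (hsub hv)
  rw [gaussianAvg_eq_add_integral_laplacian hg.contDiff y hu.1 hΦ (fun v hv => hD1 v (hsub hv))
    (fun v hv => hD2 v (hsub hv)), add_sub_cancel_left]
  refine hbound.trans (mul_le_mul_of_nonneg_right (pow_le_pow_left₀ hu.1 hu.2 2) ?_)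
  exact (abs_nonneg _).trans (abs_gaussianAvg_laplacian_le hw hg y hint hu)

theorem variance_comp_add_smul_le (ha : 0 ≤ a) :
    MemLp (fun x => g (y + a • x)) 2 (stdGaussian E) ∧
      Var[fun x => g (y + a • x); stdGaussian E] ≤ (gaussianPoincareConst E).toReal
        * (a ^ 2 * c ^ 2 * gaussianAvg (fun z => w z ^ 2) a y) := by
  obtain ⟨Φ, hΦ, hD1, -⟩ := exists_majorant hw hg y hint
  have hg1 : ContDiff ℝ 1 g := hg.contDiff.of_le one_le_two
  have hfderiv : ∀ x, ‖fderiv ℝ (fun x => g (y + a • x)) x‖ ^ 2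
      ≤ a ^ 2 * c ^ 2 * w (y + a • x) ^ 2 := fun x => by
    have haffine : HasFDerivAt (fun x : E => y + a • x) (a • ContinuousLinearMap.id ℝ E) x :=
      ((hasFDerivAt_id x).const_smul a).const_add y
    have hcomp : HasFDerivAt (fun x => g (y + a • x)) _ x :=
      (hg1.differentiable one_ne_zero _).hasFDerivAt.comp x haffine
    rw [hcomp.fderiv, ContinuousLinearMap.comp_smul, ContinuousLinearMap.comp_id, norm_smul,
      Real.norm_of_nonneg ha, mul_pow, mul_assoc, ← mul_pow c]
    gcongr
    exact hg.norm_fderiv_le _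
  rw [gaussianAvg, ← integral_const_mul]
  exact variance_stdGaussian_le (hg1.comp (by fun_prop))
    (integrable_comp_add_smul_stdGaussian hg1 y ha hΦ hD1) (hint.integrable_sq.const_mul _) hfderiv

end HasDominatedDerivs

theorem IsDominated.abs_gaussianAvg_sub_laplacian_le {ψ : E → ℝ} (hψ : IsDominated w c ψ)
    (hw : IsWeight w K) (y : E) {a : ℝ} (ha : 0 ≤ a)
    (hint : MemLp (fun x => w (y + a • x)) 2 (stdGaussian E)) :
    |gaussianAvg ψ a y - ψ y - a ^ 2 / 2 * Laplacian.laplacian ψ y|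
      ≤ a ^ 4 * (Module.finrank ℝ E
        * (c * ((1 + K) * (1 + 2 * K) * gaussianAvg w a y))) := by
  obtain ⟨Φ, hΦ, hD1, hD2⟩ := hψ.derivs.exists_majorant hw y hint
  have hremainder : gaussianAvg ψ a y - ψ y - a ^ 2 / 2 * Laplacian.laplacian ψ y
      = ∫ u in (0 : ℝ)..a, u * (gaussianAvg (Laplacian.laplacian ψ) u y
        - Laplacian.laplacian ψ y) := by
    simp only [mul_sub]
    rw [intervalIntegral.integral_sub
        (intervalIntegrable_gaussianAvg_laplacian hψ.derivs.contDiff y ha hΦ hD1 hD2)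
        (Continuous.intervalIntegrable (by fun_prop) _ _),
      intervalIntegral.integral_mul_const, integral_id,
      gaussianAvg_eq_add_integral_laplacian hψ.derivs.contDiff y ha hΦ hD1 hD2]
    ring
  rw [hremainder]
  refine (abs_integral_mul_le ha fun u hu =>
    hψ.derivs_laplacian.abs_gaussianAvg_sub_le hw y hint hu).trans_eq ?_
  ring

end GaussianExpansion

section LangevinStep

variable {w : E → ℝ} {K : ℝ} (hw : IsWeight w K) {c : ℝ} {ψ : E → ℝ} (hψ : IsDominated w c ψ)
  {x G : E} (hG : IsDriftDominated w c ψ x G) {h : ℝ} (hh : 0 ≤ h)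
  (hint : MemLp (fun ξ => w (x + (h / 2) • G + √h • ξ)) 2 (stdGaussian E))

include hw hψ hG hh hint

theorem abs_gaussianAvg_langevinStep_sub_generator_le :
    |gaussianAvg ψ √h (x + (h / 2) • G) - ψ x
        - h / 2 * (fderiv ℝ ψ x G + Laplacian.laplacian ψ x)|
      ≤ h ^ 2 * ((Module.finrank ℝ E + 1) * (c * ((1 + K) * (1 + 2 * K)
        * (w x + gaussianAvg w √h (x + (h / 2) • G))))) := by
  set y := x + (h / 2) • G
  set A := gaussianAvg w √h y
  set Q := c * ((1 + K) * (1 + 2 * K) * (w x + A)) with hQ_def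
  have hc := hψ.derivs.const_nonneg hw
  have hK := hw.const_nonneg
  have hQ : ∀ z ∈ segment ℝ x y, c * (w z + w x) ≤ Q := fun z hz =>
    mul_le_mul_of_nonneg_left (hw.add_le_of_mem_segment hz _ (hint.integrable one_le_two)) hc
  have hA : c * ((1 + K) * (1 + 2 * K) * A) ≤ Q := by
    rw [hQ_def]
    gcongr
    exact le_add_of_nonneg_left (hw.nonneg x)
  have hnoise := hψ.abs_gaussianAvg_sub_laplacian_le hw y (Real.sqrt_nonneg h) hint
  rw [show √h ^ 4 = (√h ^ 2) ^ 2 by ring, Real.sq_sqrt hh] at hnoise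
  have hdrift := hG.abs_taylor_two_le hψ.derivs.contDiff hh hQ
  have hlaplacian : |h / 2 * (Laplacian.laplacian ψ y - Laplacian.laplacian ψ x)|
      ≤ h / 2 * (h / 2 * Q) := by
    rw [abs_mul, abs_of_nonneg (by positivity : 0 ≤ h / 2)]
    gcongr
    exact hG.abs_laplacian_sub_le (hψ.derivs_laplacian.contDiff.differentiable two_ne_zero) hh hQ
  have hQ0 : 0 ≤ Q := le_trans (by have := hw.gaussianAvg_nonneg √h y; positivity) hA
  calc |gaussianAvg ψ √h y - ψ x - h / 2 * (fderiv ℝ ψ x G + Laplacian.laplacian ψ x)|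
      = |(gaussianAvg ψ √h y - ψ y - h / 2 * Laplacian.laplacian ψ y)
        + (ψ y - ψ x - h / 2 * fderiv ℝ ψ x G)
        + h / 2 * (Laplacian.laplacian ψ y - Laplacian.laplacian ψ x)| := by congr 1; ring
    _ ≤ h ^ 2 * (Module.finrank ℝ E * Q) + (h / 2) ^ 2 * Q + h / 2 * (h / 2 * Q) := by
        refine (abs_add_three _ _ _).trans (add_le_add_three (hnoise.trans ?_) hdrift hlaplacian)
        gcongr
    _ ≤ h ^ 2 * ((Module.finrank ℝ E + 1) * Q) := by nlinarith [mul_nonneg (sq_nonneg h) hQ0]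

theorem abs_gaussianAvg_langevinStep_sub_le :
    |gaussianAvg ψ √h (x + (h / 2) • G) - ψ x| ≤ h * ((Module.finrank ℝ E + 1)
      * (c * ((1 + K) * (1 + 2 * K) * (w x + gaussianAvg w √h (x + (h / 2) • G))))) := by
  set y := x + (h / 2) • G
  set A := gaussianAvg w √h y
  set Q := c * ((1 + K) * (1 + 2 * K) * (w x + A)) with hQ_def
  have hc := hψ.derivs.const_nonneg hw
  have hK := hw.const_nonneg
  have hA : c * ((1 + K) * (1 + 2 * K) * A) ≤ Q := by
    rw [hQ_def]
    gcongr
    exact le_add_of_nonneg_left (hw.nonneg x)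
  have hQ0 : 0 ≤ Q := le_trans (by have := hw.gaussianAvg_nonneg √h y; positivity) hA
  have hnoise := hψ.derivs.abs_gaussianAvg_sub_le hw y hint ⟨Real.sqrt_nonneg h, le_rfl⟩
  rw [Real.sq_sqrt hh] at hnoise
  have hdrift := hG.abs_sub_le (hψ.derivs.contDiff.differentiable two_ne_zero) hh fun z hz =>
    mul_le_mul_of_nonneg_left (hw.add_le_of_mem_segment hz _ (hint.integrable one_le_two)) hc
  calc |gaussianAvg ψ √h y - ψ x| ≤ |gaussianAvg ψ √h y - ψ y| + |ψ y - ψ x| :=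
        abs_sub_le _ _ _
    _ ≤ h * (Module.finrank ℝ E * Q) + h / 2 * Q := by
        refine add_le_add (hnoise.trans ?_) hdrift
        gcongr
    _ ≤ h * ((Module.finrank ℝ E + 1) * Q) := by nlinarith [mul_nonneg hh hQ0]

theorem gaussianAvg_langevinStep_sub_sq_le (h1 : h ≤ 1) :
    gaussianAvg (fun z => (ψ z - ψ x) ^ 2) √h (x + (h / 2) • G)
      ≤ h * (((gaussianPoincareConst E).toReal * c ^ 2
          + 2 * ((Module.finrank ℝ E + 1) * (c * ((1 + K) * (1 + 2 * K)))) ^ 2)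
        * (w x ^ 2 + gaussianAvg (fun z => w z ^ 2) √h (x + (h / 2) • G))) := by
  set y := x + (h / 2) • G
  set A₂ := gaussianAvg (fun z => w z ^ 2) √h y
  set P := (gaussianPoincareConst E).toReal
  set L := (Module.finrank ℝ E + 1) * (c * ((1 + K) * (1 + 2 * K))) with hL
  have : 0 ≤ P := ENNReal.toReal_nonneg
  have hsum : (w x + gaussianAvg w √h y) ^ 2 ≤ 2 * (w x ^ 2 + A₂) :=
    add_sq_le.trans (by gcongr; exact sq_integral_le_integral_sq hint)
  obtain ⟨hψ_mem, hvar⟩ := hψ.derivs.variance_comp_add_smul_le hw y hint (Real.sqrt_nonneg h)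
  rw [Real.sq_sqrt hh] at hvar
  have hmean : (gaussianAvg ψ √h y - ψ x) ^ 2
      ≤ h ^ 2 * (L ^ 2 * (w x + gaussianAvg w √h y) ^ 2) := by
    rw [← sq_abs]
    refine (pow_le_pow_left₀ (abs_nonneg _)
      (abs_gaussianAvg_langevinStep_sub_le hw hψ hG hh hint) 2).trans_eq ?_
    rw [hL]
    ring
  have hdecomp : gaussianAvg (fun z => (ψ z - ψ x) ^ 2) √h y
      = Var[fun ξ => ψ (y + √h • ξ); stdGaussian E] + (gaussianAvg ψ √h y - ψ x) ^ 2 := by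
    have hsub_mem : MemLp (fun ξ => ψ (y + √h • ξ) - ψ x) 2 (stdGaussian E) :=
      hψ_mem.sub (memLp_const _)
    rw [← variance_sub_const hψ_mem.aestronglyMeasurable (ψ x), variance_eq_sub hsub_mem,
      integral_sub (hψ_mem.integrable one_le_two) (integrable_const _), integral_const,
      probReal_univ, one_smul]
    exact (sub_add_cancel _ _).symm
  have hh2 : h ^ 2 ≤ h := by nlinarith
  rw [hdecomp]
  calc Var[fun ξ => ψ (y + √h • ξ); stdGaussian E] + (gaussianAvg ψ √h y - ψ x) ^ 2
      ≤ P * (h * c ^ 2 * A₂) + h * (L ^ 2 * (2 * (w x ^ 2 + A₂))) :=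
        add_le_add hvar (hmean.trans (by gcongr))
    _ ≤ P * (h * c ^ 2 * (w x ^ 2 + A₂)) + h * (L ^ 2 * (2 * (w x ^ 2 + A₂))) := by
        gcongr
        exact le_add_of_nonneg_left (sq_nonneg _)
    _ = h * ((P * c ^ 2 + 2 * L ^ 2) * (w x ^ 2 + A₂)) := by ring

end LangevinStep

end Weight

section MarkovChain

variable {Ω E Z : Type*} [mΩ : MeasurableSpace Ω] [MeasurableSpace E] [MeasurableSpace Z]

section SecondMoment

variable {P : Measure Ω}

theorem memLp_two_of_sq_le {f g : Ω → ℝ} (hf : AEStronglyMeasurable f P) (hg : Integrable g P)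
    (hle : ∀ᵐ ω ∂P, f ω ^ 2 ≤ g ω) : MemLp f 2 P := by
  refine (memLp_two_iff_integrable_sq hf).2 (hg.mono' (hf.pow 2) ?_)
  filter_upwards [hle] with ω hω
  rwa [Real.norm_of_nonneg (sq_nonneg _)]

theorem integral_sum_sq_le {f : ℕ → Ω → ℝ} {A : ℝ} (hf : ∀ t, MemLp (f t) 2 P)
    (hA : ∀ t, ∫ ω, f t ω ^ 2 ∂P ≤ A) (T : ℕ) :
    ∫ ω, (∑ t ∈ Finset.range T, f t ω) ^ 2 ∂P ≤ T ^ 2 * A := by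
  calc ∫ ω, (∑ t ∈ Finset.range T, f t ω) ^ 2 ∂P
      ≤ ∫ ω, T * ∑ t ∈ Finset.range T, f t ω ^ 2 ∂P := by
        refine integral_mono (memLp_finsetSum _ fun t _ => hf t).integrable_sq
          ((integrable_finsetSum _ fun t _ => (hf t).integrable_sq).const_mul _) fun ω => ?_
        simpa only [Finset.card_range] using
          sq_sum_le_card_mul_sum_sq (s := Finset.range T) (f := fun t => f t ω)
    _ = T * ∑ t ∈ Finset.range T, ∫ ω, f t ω ^ 2 ∂P := by
        rw [integral_const_mul, integral_finsetSum _ fun t _ => (hf t).integrable_sq]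
    _ ≤ T * (T * A) := by
        gcongr
        simpa only [Finset.card_range, nsmul_eq_mul] using
          Finset.sum_le_card_nsmul (Finset.range T) _ A fun t _ => hA t
    _ = T ^ 2 * A := by ring

theorem integral_sum_sq_le_of_orthogonal {D : ℕ → Ω → ℝ} {A : ℝ} (hD : ∀ t, MemLp (D t) 2 P)
    (horth : ∀ t, ∫ ω, (∑ s ∈ Finset.range t, D s ω) * D t ω ∂P = 0)
    (hA : ∀ t, ∫ ω, D t ω ^ 2 ∂P ≤ A) (T : ℕ) :
    ∫ ω, (∑ t ∈ Finset.range T, D t ω) ^ 2 ∂P ≤ T * A := by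
  induction T with
  | zero => simp
  | succ T ih =>
    have hS : MemLp (fun ω => ∑ s ∈ Finset.range T, D s ω) 2 P :=
      memLp_finsetSum _ fun t _ => hD t
    have hcross : Integrable (fun ω => (∑ s ∈ Finset.range T, D s ω) * D T ω) P :=
      hS.integrable_mul (hD T)
    have hsum : Integrable (fun ω => (∑ s ∈ Finset.range T, D s ω) ^ 2
        + 2 * ((∑ s ∈ Finset.range T, D s ω) * D T ω)) P :=
      hS.integrable_sq.add (hcross.const_mul 2)
    simp only [Finset.sum_range_succ, add_sq, mul_assoc]
    rw [integral_add hsum (hD T).integrable_sq,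
      integral_add hS.integrable_sq (hcross.const_mul 2), integral_const_mul, horth]
    push_cast
    linarith [hA T]

end SecondMoment

section TransitionOp

variable {Ω E Z : Type*} [MeasurableSpace Z]

/-- The transition operator of the chain with update rule `F` and noise law `ζ`: the expectation
of `ψ` after one step from `x`. -/
noncomputable def transitionOp (ζ : Measure Z) (F : E → Z → E) (ψ : E → ℝ) (x : E) : ℝ :=
  ∫ s, ψ (F x s) ∂ζ

/-- The martingale increment of `ψ` along the chain: what the step from time `t` to time `t + 1`
adds to the conditional expectation of `ψ` given the past. -/
noncomputable def martingaleIncr (ζ : Measure Z) (F : E → Z → E) (ψ : E → ℝ) (θ : ℕ → Ω → E)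
    (t : ℕ) (ω : Ω) : ℝ :=
  ψ (θ (t + 1) ω) - transitionOp ζ F ψ (θ t ω)

theorem mul_sum_eq_sub_martingaleIncr (ζ : Measure Z) (F : E → Z → E) (ψ L : E → ℝ) (h : ℝ)
    (θ : ℕ → Ω → E) (T : ℕ) (ω : Ω) :
    h * ∑ t ∈ Finset.range T, L (θ (t + 1) ω) = ψ (θ (T + 1) ω) - ψ (θ 1 ω)
      - ∑ t ∈ Finset.range T, martingaleIncr ζ F ψ θ (t + 1) ω
      - ∑ t ∈ Finset.range T,
        (transitionOp ζ F ψ (θ (t + 1) ω) - ψ (θ (t + 1) ω) - h * L (θ (t + 1) ω)) := by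
  rw [← zero_add 1, ← Finset.sum_range_sub (fun t => ψ (θ (t + (0 + 1)) ω)) T,
    ← Finset.sum_sub_distrib, ← Finset.sum_sub_distrib, Finset.mul_sum]
  refine Finset.sum_congr rfl fun t _ => ?_
  rw [martingaleIncr]
  ring

end TransitionOp

/-- `θ` is the Markov chain with update rule `F` driven by noise `z` of law `ζ`: the noise used at
time `t` is independent of the past `𝓕 t`, to which `θ t` is adapted. -/
structure IsNoiseDriven (P : Measure Ω) (ζ : Measure Z) (F : E → Z → E) (𝓕 : Filtration ℕ mΩ)
    (θ : ℕ → Ω → E) (z : ℕ → Ω → Z) : Prop where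
  measurable_update : Measurable (Function.uncurry F)
  measurable_state : ∀ t, Measurable[𝓕 t] (θ t)
  measurable_noise : ∀ t, Measurable (z t)
  law : ∀ t, P.map (z t) = ζ
  indep : ∀ t, Indep (𝓕 t) (MeasurableSpace.comap (z t) inferInstance) P
  step : ∀ t ω, θ (t + 1) ω = F (θ t ω) (z t ω)

/-- The function `v` has expectation at most `K` along the whole process `θ`. -/
structure IsMomentBounded (P : Measure Ω) (θ : ℕ → Ω → E) (v : E → ℝ) (K : ℝ) : Prop where
  measurable : Measurable v
  integrable : ∀ t, Integrable (fun ω => v (θ t ω)) P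
  integral_le : ∀ t, ∫ ω, v (θ t ω) ∂P ≤ K

/-- `ψ` solves the Poisson equation with right-hand side `L` up to the discretization error of
step size `h`: the expected increment of `ψ` in one step is `h * L`, up to order `h ^ 2`, and the
increment itself is of order `√h`. The sizes are measured by the weight `v` of quadratic type. -/
structure IsApproxPoisson (ζ : Measure Z) (F : E → Z → E) (v : E → ℝ) (C h : ℝ) (ψ L : E → ℝ) :
    Prop where
  measurable : Measurable ψ
  measurable_rhs : Measurable L
  sq_le : ∀ x, ψ x ^ 2 ≤ C * v x
  rhs_sq_le : ∀ x, L x ^ 2 ≤ C * v x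
  bias_sq_le : ∀ x, Integrable (fun s => v (F x s)) ζ →
    (transitionOp ζ F ψ x - ψ x - h * L x) ^ 2 ≤ h ^ 4 * (C * (v x + transitionOp ζ F v x))
  displacement_sq_le : h ≤ 1 → ∀ x, Integrable (fun s => v (F x s)) ζ →
    transitionOp ζ F (fun y => (ψ y - ψ x) ^ 2) x ≤ h * (C * (v x + transitionOp ζ F v x))

namespace IsMomentBounded

variable {P : Measure Ω} {θ : ℕ → Ω → E} {v f : E → ℝ} {K C : ℝ}

theorem memLp_comp (hv : IsMomentBounded P θ v K) (hf : Measurable f)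
    (hle : ∀ x, f x ^ 2 ≤ C * v x) {t : ℕ} (hθ : Measurable (θ t)) :
    MemLp (fun ω => f (θ t ω)) 2 P :=
  memLp_two_of_sq_le (hf.comp hθ).aestronglyMeasurable ((hv.integrable t).const_mul C)
    (.of_forall fun _ => hle _)

theorem integral_comp_sq_le (hv : IsMomentBounded P θ v K) (hle : ∀ x, f x ^ 2 ≤ C * v x)
    (hC : 0 ≤ C) (t : ℕ) : ∫ ω, f (θ t ω) ^ 2 ∂P ≤ C * K := by
  refine (integral_mono_of_nonneg (.of_forall fun _ => sq_nonneg _)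
    ((hv.integrable t).const_mul C) (.of_forall fun _ => hle _)).trans ?_
  rw [integral_const_mul]
  exact mul_le_mul_of_nonneg_left (hv.integral_le t) hC

theorem memLp_average (hv : IsMomentBounded P θ v K) (hf : Measurable f)
    (hle : ∀ x, f x ^ 2 ≤ C * v x) (hθ : ∀ t, Measurable (θ t)) (T : ℕ) :
    MemLp (fun ω => (T : ℝ)⁻¹ * ∑ t ∈ Finset.range T, f (θ (t + 1) ω)) 2 P :=
  (memLp_finsetSum _ fun t _ => hv.memLp_comp hf hle (hθ (t + 1))).const_mul _

theorem integral_average_sq_le_const (hv : IsMomentBounded P θ v K) (hf : Measurable f)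
    (hle : ∀ x, f x ^ 2 ≤ C * v x) (hθ : ∀ t, Measurable (θ t)) (hC : 0 ≤ C) {T : ℕ}
    (hT : 0 < T) :
    ∫ ω, ((T : ℝ)⁻¹ * ∑ t ∈ Finset.range T, f (θ (t + 1) ω)) ^ 2 ∂P ≤ C * K := by
  have hsum := integral_sum_sq_le (fun t => hv.memLp_comp hf hle (hθ (t + 1)))
    (fun t => hv.integral_comp_sq_le hle hC (t + 1)) T
  simp_rw [mul_pow]
  rw [integral_const_mul]
  calc (T : ℝ)⁻¹ ^ 2 * ∫ ω, (∑ t ∈ Finset.range T, f (θ (t + 1) ω)) ^ 2 ∂P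
      ≤ (T : ℝ)⁻¹ ^ 2 * (T ^ 2 * (C * K)) := by gcongr
    _ = C * K := by field_simp

end IsMomentBounded

theorem measurable_transitionOp {ζ : Measure Z} [SFinite ζ] {F : E → Z → E}
    (hF : Measurable (Function.uncurry F)) {ψ : E → ℝ} (hψ : Measurable ψ) :
    Measurable (transitionOp ζ F ψ) :=
  (hψ.comp hF).stronglyMeasurable.integral_prod_right'.measurable

namespace IsNoiseDriven

variable {P : Measure Ω} {ζ : Measure Z} {F : E → Z → E} {𝓕 : Filtration ℕ mΩ} {θ : ℕ → Ω → E}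
  {z : ℕ → Ω → Z} (hM : IsNoiseDriven P ζ F 𝓕 θ z)

include hM

theorem measurable_chain (t : ℕ) : Measurable (θ t) :=
  (hM.measurable_state t).mono (𝓕.le t) le_rfl

theorem measurable_update_apply (x : E) : Measurable (F x) :=
  hM.measurable_update.comp measurable_prodMk_left

theorem measurable_martingaleIncr [SFinite ζ] {ψ : E → ℝ} (hψ : Measurable ψ) (t : ℕ) :
    Measurable[𝓕 (t + 1)] (martingaleIncr ζ F ψ θ t) :=
  (hψ.comp (hM.measurable_state (t + 1))).sub ((measurable_transitionOp hM.measurable_update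
    hψ).comp ((hM.measurable_state t).mono (𝓕.mono t.le_succ) le_rfl))

section Noise

variable [IsFiniteMeasure P] {α : Type*} [MeasurableSpace α] {t : ℕ} {X : Ω → α}
  (hX : Measurable[𝓕 t] X)

include hX

theorem map_prodMk_noise : P.map (fun ω => (X ω, z t ω)) = (P.map X).prod ζ := by
  have hindep : IndepFun X (z t) P :=
    (IndepFun_iff_Indep _ _ _).2 (indep_of_indep_of_le_left (hM.indep t) hX.comap_le)
  rw [← hM.law t]
  exact (indepFun_iff_map_prod_eq_prod_map_map (hX.mono (𝓕.le t) le_rfl).aemeasurable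
    (hM.measurable_noise t).aemeasurable).1 hindep

variable {f : α × Z → ℝ} (hf : Measurable f) (hint : Integrable (fun ω => f (X ω, z t ω)) P)

include hf hint

theorem integrable_map_prod : Integrable f ((P.map X).prod ζ) := by
  rw [← hM.map_prodMk_noise hX, integrable_map_measure hf.aestronglyMeasurable
    ((hX.mono (𝓕.le t) le_rfl).prodMk (hM.measurable_noise t)).aemeasurable]
  exact hint

variable [SFinite ζ]

theorem ae_integrable_noise : ∀ᵐ ω ∂P, Integrable (fun s => f (X ω, s)) ζ :=
  ae_of_ae_map (hX.mono (𝓕.le t) le_rfl).aemeasurable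
    (hM.integrable_map_prod hX hf hint).prod_right_ae

theorem integrable_integral_noise : Integrable (fun ω => ∫ s, f (X ω, s) ∂ζ) P :=
  (hM.integrable_map_prod hX hf hint).integral_prod_left.comp_measurable (hX.mono (𝓕.le t) le_rfl)

theorem integral_noise : ∫ ω, f (X ω, z t ω) ∂P = ∫ ω, ∫ s, f (X ω, s) ∂ζ ∂P := by
  have hX' : Measurable X := hX.mono (𝓕.le t) le_rfl
  have hprod := hM.integrable_map_prod hX hf hint
  calc ∫ ω, f (X ω, z t ω) ∂P = ∫ q, f q ∂((P.map X).prod ζ) := by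
        rw [← hM.map_prodMk_noise hX, integral_map
          (hX'.prodMk (hM.measurable_noise t)).aemeasurable hf.aestronglyMeasurable]
    _ = ∫ ω, ∫ s, f (X ω, s) ∂ζ ∂P := by
        rw [integral_prod _ hprod, integral_map hX'.aemeasurable
          hprod.integral_prod_left.aestronglyMeasurable]

end Noise

section Moments

variable {v : E → ℝ} {K : ℝ} (hv : IsMomentBounded P θ v K) (t : ℕ)

include hv

theorem integrable_update : Integrable (fun ω => v (F (θ t ω) (z t ω))) P := by
  simpa only [hM.step] using hv.integrable (t + 1)

variable [IsFiniteMeasure P] [SFinite ζ]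

theorem ae_integrable_update : ∀ᵐ ω ∂P, Integrable (fun s => v (F (θ t ω) s)) ζ :=
  hM.ae_integrable_noise (hM.measurable_state t) (hv.measurable.comp hM.measurable_update)
    (hM.integrable_update hv t)

theorem integrable_transitionOp : Integrable (fun ω => transitionOp ζ F v (θ t ω)) P :=
  hM.integrable_integral_noise (hM.measurable_state t) (hv.measurable.comp hM.measurable_update)
    (hM.integrable_update hv t)

theorem integrable_add_transitionOp :
    Integrable (fun ω => v (θ t ω) + transitionOp ζ F v (θ t ω)) P :=
  (hv.integrable t).add (hM.integrable_transitionOp hv t)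

theorem integral_add_transitionOp_le :
    ∫ ω, (v (θ t ω) + transitionOp ζ F v (θ t ω)) ∂P ≤ 2 * K := by
  have hnoise : ∫ ω, v (F (θ t ω) (z t ω)) ∂P = ∫ ω, transitionOp ζ F v (θ t ω) ∂P :=
    hM.integral_noise (hM.measurable_state t) (hv.measurable.comp hM.measurable_update)
      (hM.integrable_update hv t)
  rw [integral_add (hv.integrable t) (hM.integrable_transitionOp hv t), ← hnoise, two_mul]
  simp only [← hM.step]
  exact add_le_add (hv.integral_le t) (hv.integral_le (t + 1))

end Moments

variable [IsFiniteMeasure P] [IsProbabilityMeasure ζ] {v : E → ℝ} {K : ℝ}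
  (hv : IsMomentBounded P θ v K)

include hv

section Increments

variable {ψ : E → ℝ} {C : ℝ} (hψ : Measurable ψ) (hle : ∀ x, ψ x ^ 2 ≤ C * v x) (t : ℕ)

include hψ hle

theorem ae_memLp_update : ∀ᵐ ω ∂P, MemLp (fun s => ψ (F (θ t ω) s)) 2 ζ := by
  filter_upwards [hM.ae_integrable_update hv t] with ω hω
  exact memLp_two_of_sq_le (hψ.comp (hM.measurable_update_apply _)).aestronglyMeasurable
    (hω.const_mul C) (.of_forall fun s => hle _)

theorem memLp_transitionOp : MemLp (fun ω => transitionOp ζ F ψ (θ t ω)) 2 P := by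
  refine memLp_two_of_sq_le ((measurable_transitionOp hM.measurable_update hψ).comp
    (hM.measurable_chain t)).aestronglyMeasurable
    ((hM.integrable_transitionOp hv t).const_mul C) ?_
  filter_upwards [hM.ae_integrable_update hv t, hM.ae_memLp_update hv hψ hle t] with ω hvω hψω
  calc transitionOp ζ F ψ (θ t ω) ^ 2 ≤ ∫ s, ψ (F (θ t ω) s) ^ 2 ∂ζ :=
        sq_integral_le_integral_sq hψω
    _ ≤ ∫ s, C * v (F (θ t ω) s) ∂ζ :=
        integral_mono hψω.integrable_sq (hvω.const_mul C) fun _ => hle _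
    _ = C * transitionOp ζ F v (θ t ω) := integral_const_mul _ _

theorem memLp_martingaleIncr : MemLp (martingaleIncr ζ F ψ θ t) 2 P :=
  (hv.memLp_comp hψ hle (hM.measurable_chain (t + 1))).sub (hM.memLp_transitionOp hv hψ hle t)

theorem integral_mul_martingaleIncr_eq_zero {S : Ω → ℝ} (hS : Measurable[𝓕 t] S)
    (hS2 : MemLp S 2 P) : ∫ ω, S ω * martingaleIncr ζ F ψ θ t ω ∂P = 0 := by
  have hint : Integrable (fun ω => S ω * martingaleIncr ζ F ψ θ t ω) P :=
    hS2.integrable_mul (hM.memLp_martingaleIncr hv hψ hle t)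
  have hf : Measurable (fun q : (ℝ × E) × Z =>
      q.1.1 * (ψ (F q.1.2 q.2) - transitionOp ζ F ψ q.1.2)) := by
    have hupdate : Measurable (fun q : (ℝ × E) × Z => ψ (F q.1.2 q.2)) :=
      (hψ.comp hM.measurable_update).comp (measurable_fst.snd.prodMk measurable_snd)
    have hmean : Measurable (fun q : (ℝ × E) × Z => transitionOp ζ F ψ q.1.2) :=
      (measurable_transitionOp hM.measurable_update hψ).comp measurable_fst.snd
    exact measurable_fst.fst.mul (hupdate.sub hmean)
  simp only [martingaleIncr, hM.step] at hint ⊢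
  refine (hM.integral_noise (hS.prodMk (hM.measurable_state t)) hf hint).trans
    (integral_eq_zero_of_ae ?_)
  filter_upwards [hM.ae_memLp_update hv hψ hle t] with ω hω
  rw [integral_const_mul, integral_sub (hω.integrable one_le_two) (integrable_const _),
    integral_const, probReal_univ, one_smul, transitionOp, sub_self, mul_zero, Pi.zero_apply]

theorem integral_martingaleIncr_sq_le {h : ℝ} (hh : 0 ≤ h) (hC : 0 ≤ C)
    (hdisp : ∀ x, Integrable (fun s => v (F x s)) ζ →
      transitionOp ζ F (fun y => (ψ y - ψ x) ^ 2) x ≤ h * (C * (v x + transitionOp ζ F v x))) :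
    ∫ ω, martingaleIncr ζ F ψ θ t ω ^ 2 ∂P ≤ h * (C * (2 * K)) := by
  have hint := (hM.memLp_martingaleIncr hv hψ hle t).integrable_sq
  have hf : Measurable (fun q : E × Z => (ψ (F q.1 q.2) - transitionOp ζ F ψ q.1) ^ 2) :=
    ((hψ.comp hM.measurable_update).sub
      ((measurable_transitionOp hM.measurable_update hψ).comp measurable_fst)).pow_const 2
  have hvar : ∀ᵐ ω ∂P, ∫ s, (ψ (F (θ t ω) s) - transitionOp ζ F ψ (θ t ω)) ^ 2 ∂ζ
      ≤ h * (C * (v (θ t ω) + transitionOp ζ F v (θ t ω))) := by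
    filter_upwards [hM.ae_integrable_update hv t, hM.ae_memLp_update hv hψ hle t] with ω hvω hψω
    refine le_trans ?_ (hdisp _ hvω)
    calc ∫ s, (ψ (F (θ t ω) s) - transitionOp ζ F ψ (θ t ω)) ^ 2 ∂ζ
        = Var[fun s => ψ (F (θ t ω) s) - ψ (θ t ω); ζ] := by
          rw [variance_sub_const hψω.aestronglyMeasurable, variance_eq_integral hψω.aemeasurable]
          rfl
      _ ≤ transitionOp ζ F (fun y => (ψ y - ψ (θ t ω)) ^ 2) (θ t ω) :=
          variance_le_expectation_sq (hψω.sub (memLp_const _)).aestronglyMeasurable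
  simp only [martingaleIncr, hM.step] at hint ⊢
  calc ∫ ω, (ψ (F (θ t ω) (z t ω)) - transitionOp ζ F ψ (θ t ω)) ^ 2 ∂P
      = ∫ ω, ∫ s, (ψ (F (θ t ω) s) - transitionOp ζ F ψ (θ t ω)) ^ 2 ∂ζ ∂P :=
        hM.integral_noise (hM.measurable_state t) hf hint
    _ ≤ ∫ ω, h * (C * (v (θ t ω) + transitionOp ζ F v (θ t ω))) ∂P :=
        integral_mono_ae (hM.integrable_integral_noise (hM.measurable_state t) hf hint)
          (((hM.integrable_add_transitionOp hv t).const_mul C).const_mul h) hvar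
    _ ≤ h * (C * (2 * K)) := by
        rw [integral_const_mul, integral_const_mul]
        gcongr
        exact hM.integral_add_transitionOp_le hv t

end Increments

section Poisson

variable {ψ L : E → ℝ} {C h : ℝ} (hP : IsApproxPoisson ζ F v C h ψ L)

include hP

theorem memLp_bias (t : ℕ) :
    MemLp (fun ω => transitionOp ζ F ψ (θ t ω) - ψ (θ t ω) - h * L (θ t ω)) 2 P := by
  have hθ := hM.measurable_chain t
  exact ((hM.memLp_transitionOp hv hP.measurable hP.sq_le t).sub
    (hv.memLp_comp hP.measurable hP.sq_le hθ)).sub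
    ((hv.memLp_comp hP.measurable_rhs hP.rhs_sq_le hθ).const_mul h)

theorem integral_bias_sq_le (hC : 0 ≤ C) (t : ℕ) :
    ∫ ω, (transitionOp ζ F ψ (θ t ω) - ψ (θ t ω) - h * L (θ t ω)) ^ 2 ∂P
      ≤ h ^ 4 * (C * (2 * K)) := by
  calc ∫ ω, (transitionOp ζ F ψ (θ t ω) - ψ (θ t ω) - h * L (θ t ω)) ^ 2 ∂P
      ≤ ∫ ω, h ^ 4 * (C * (v (θ t ω) + transitionOp ζ F v (θ t ω))) ∂P := by
        refine integral_mono_ae (hM.memLp_bias hv hP t).integrable_sq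
          (((hM.integrable_add_transitionOp hv t).const_mul C).const_mul _) ?_
        filter_upwards [hM.ae_integrable_update hv t] with ω hω using hP.bias_sq_le _ hω
    _ ≤ h ^ 4 * (C * (2 * K)) := by
        rw [integral_const_mul, integral_const_mul]
        gcongr
        exact hM.integral_add_transitionOp_le hv t

theorem integral_sum_martingaleIncr_sq_le (hC : 0 ≤ C) (hh : 0 ≤ h) (h1 : h ≤ 1) (T : ℕ) :
    ∫ ω, (∑ t ∈ Finset.range T, martingaleIncr ζ F ψ θ (t + 1) ω) ^ 2 ∂P
      ≤ T * (h * (C * (2 * K))) := by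
  have hincr : ∀ t, MemLp (martingaleIncr ζ F ψ θ (t + 1)) 2 P := fun t =>
    hM.memLp_martingaleIncr hv hP.measurable hP.sq_le (t + 1)
  refine integral_sum_sq_le_of_orthogonal hincr (fun t => ?_) (fun t =>
    hM.integral_martingaleIncr_sq_le hv hP.measurable hP.sq_le (t + 1) hh hC
      (hP.displacement_sq_le h1)) T
  refine hM.integral_mul_martingaleIncr_eq_zero hv hP.measurable hP.sq_le (t + 1)
    (Finset.measurable_fun_sum _ fun s hs => ?_) (memLp_finsetSum _ fun s _ => hincr s)
  exact (hM.measurable_martingaleIncr hP.measurable (s + 1)).mono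
    (𝓕.mono (by have := Finset.mem_range.1 hs; lia)) le_rfl

theorem integral_mul_sum_sq_le (hC : 0 ≤ C) (hh : 0 ≤ h) (h1 : h ≤ 1) (T : ℕ) :
    ∫ ω, (h * ∑ t ∈ Finset.range T, L (θ (t + 1) ω)) ^ 2 ∂P
      ≤ 8 * (C * K) * (1 + T * h + T ^ 2 * h ^ 4) := by
  set D : Ω → ℝ := fun ω => ∑ t ∈ Finset.range T, martingaleIncr ζ F ψ θ (t + 1) ω
  set R : Ω → ℝ := fun ω => ∑ t ∈ Finset.range T,
    (transitionOp ζ F ψ (θ (t + 1) ω) - ψ (θ (t + 1) ω) - h * L (θ (t + 1) ω))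
  have hψ_int : ∀ t, Integrable (fun ω => ψ (θ t ω) ^ 2) P := fun t =>
    (hv.memLp_comp hP.measurable hP.sq_le (hM.measurable_chain t)).integrable_sq
  have hD_int : Integrable (fun ω => D ω ^ 2) P :=
    (memLp_finsetSum _ fun t _ =>
      hM.memLp_martingaleIncr hv hP.measurable hP.sq_le (t + 1)).integrable_sq
  have hR_int : Integrable (fun ω => R ω ^ 2) P :=
    (memLp_finsetSum _ fun t _ => hM.memLp_bias hv hP (t + 1)).integrable_sq
  have hψ_le : ∀ t, ∫ ω, ψ (θ t ω) ^ 2 ∂P ≤ C * K := hv.integral_comp_sq_le hP.sq_le hC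
  have hD_le : ∫ ω, D ω ^ 2 ∂P ≤ T * (h * (C * (2 * K))) :=
    hM.integral_sum_martingaleIncr_sq_le hv hP hC hh h1 T
  have hR_le : ∫ ω, R ω ^ 2 ∂P ≤ T ^ 2 * (h ^ 4 * (C * (2 * K))) :=
    integral_sum_sq_le (fun t => hM.memLp_bias hv hP (t + 1))
      (fun t => hM.integral_bias_sq_le hv hP hC (t + 1)) T
  have hsq : ∀ a b c d : ℝ, (a - b - c - d) ^ 2 ≤ 4 * (a ^ 2 + b ^ 2 + (c ^ 2 + d ^ 2)) :=
    fun a b c d => by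
      nlinarith only [sq_nonneg (a + b), sq_nonneg (a + c), sq_nonneg (a + d), sq_nonneg (b - c),
        sq_nonneg (b - d), sq_nonneg (c - d)]
  have hψψ : Integrable (fun ω => ψ (θ (T + 1) ω) ^ 2 + ψ (θ 1 ω) ^ 2) P :=
    (hψ_int _).add (hψ_int _)
  have hDR : Integrable (fun ω => D ω ^ 2 + R ω ^ 2) P := hD_int.add hR_int
  calc ∫ ω, (h * ∑ t ∈ Finset.range T, L (θ (t + 1) ω)) ^ 2 ∂P
      ≤ ∫ ω, 4 * (ψ (θ (T + 1) ω) ^ 2 + ψ (θ 1 ω) ^ 2 + (D ω ^ 2 + R ω ^ 2)) ∂P := by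
        simp_rw [mul_sum_eq_sub_martingaleIncr ζ F ψ L h θ]
        exact integral_mono_of_nonneg (.of_forall fun _ => sq_nonneg _)
          ((hψψ.add hDR).const_mul 4) (.of_forall fun _ => hsq _ _ _ _)
    _ ≤ 4 * (C * K + C * K + (T * (h * (C * (2 * K))) + T ^ 2 * (h ^ 4 * (C * (2 * K))))) := by
        rw [integral_const_mul, integral_add hψψ hDR, integral_add (hψ_int _) (hψ_int _),
          integral_add hD_int hR_int]
        gcongr <;> exact hψ_le _
    _ = 8 * (C * K) * (1 + T * h + T ^ 2 * h ^ 4) := by ring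

theorem integral_average_sq_le (hC : 0 ≤ C) (hh : 0 < h) {T : ℕ} (hT : 0 < T) :
    ∫ ω, ((T : ℝ)⁻¹ * ∑ t ∈ Finset.range T, L (θ (t + 1) ω)) ^ 2 ∂P
      ≤ 16 * (C * K) * (1 / (h * T) + h ^ 2) := by
  have hCK : 0 ≤ C * K :=
    (integral_nonneg fun _ => sq_nonneg _).trans (hv.integral_comp_sq_le hP.sq_le hC 0)
  have : (0 : ℝ) < T := Nat.cast_pos.2 hT
  set q := 1 / (h * T) with hq_def
  have hq : 0 < q := by positivity
  -- Steps `h > 1` have no useful bias bound, but then the right-hand side is of order one.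
  rcases le_or_gt 1 (q + h ^ 2) with hlarge | hsmall
  · refine (hv.integral_average_sq_le_const hP.measurable_rhs hP.rhs_sq_le hM.measurable_chain
      hC hT).trans ?_
    nlinarith only [mul_le_mul_of_nonneg_left hlarge hCK, hCK]
  · have hh1 : h ≤ 1 := by nlinarith only [hsmall, hq, hh]
    have hqq : q ^ 2 ≤ q := by nlinarith only [hsmall, hq, hh]
    have hscale : ∀ ω, (T : ℝ)⁻¹ * ∑ t ∈ Finset.range T, L (θ (t + 1) ω)
        = q * (h * ∑ t ∈ Finset.range T, L (θ (t + 1) ω)) := fun ω => by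
      rw [hq_def]
      field_simp
    simp_rw [hscale, mul_pow q]
    rw [integral_const_mul]
    calc q ^ 2 * ∫ ω, (h * ∑ t ∈ Finset.range T, L (θ (t + 1) ω)) ^ 2 ∂P
        ≤ q ^ 2 * (8 * (C * K) * (1 + T * h + T ^ 2 * h ^ 4)) := by
          gcongr
          exact hM.integral_mul_sum_sq_le hv hP hC hh.le hh1 T
      _ = 8 * (C * K) * (q ^ 2 + q + h ^ 2) := by
          rw [hq_def]
          field_simp
      _ ≤ 8 * (C * K) * (2 * (q + h ^ 2)) := by
          gcongr
          nlinarith only [hqq, sq_nonneg h]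
      _ = 16 * (C * K) * (q + h ^ 2) := by ring

end Poisson

end IsNoiseDriven

end MarkovChain

section RandomDrift

variable {E : Type*} [NormedAddCommGroup E] [InnerProductSpace ℝ E]
  {β : Type*} [MeasurableSpace β]

/-- One step of size `h` of the Langevin scheme from `x`, where the noise `s` consists of the
random input `s.1` of the drift estimator `G` and of the Gaussian vector `s.2`. -/
noncomputable def langevinUpdate (G : E → β → E) (h : ℝ) (x : E) (s : β × E) : E :=
  x + (h / 2) • G x s.1 + √h • s.2

variable [FiniteDimensional ℝ E] [MeasurableSpace E] [BorelSpace E] {G : E → β → E} {h : ℝ}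

theorem measurable_langevinUpdate (hG : Measurable (Function.uncurry G)) (h : ℝ) :
    Measurable (Function.uncurry (langevinUpdate G h)) := by
  have hdrift : Measurable (fun q : E × β × E => G q.1 q.2.1) :=
    hG.comp (measurable_fst.prodMk measurable_snd.fst)
  exact (measurable_fst.add (hdrift.const_smul _)).add (measurable_snd.snd.const_smul _)

section

variable {ν : Measure β} {w : E → ℝ} {K : ℝ} {x : E}

theorem IsWeight.ae_memLp_langevinUpdate [SFinite ν] (hw : IsWeight w K)
    (hint : Integrable (fun s => w (langevinUpdate G h x s) ^ 2) (ν.prod (stdGaussian E))) :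
    ∀ᵐ b ∂ν, MemLp (fun ξ => w (x + (h / 2) • G x b + √h • ξ)) 2 (stdGaussian E) := by
  filter_upwards [hint.prod_right_ae] with b hb
  exact (memLp_two_iff_integrable_sq
    (hw.measurable.comp (by fun_prop)).aestronglyMeasurable).2 hb

variable (hG : Measurable (Function.uncurry G)) (hw : IsWeight w K)
  (hint : Integrable (fun s => w (langevinUpdate G h x s) ^ 2) (ν.prod (stdGaussian E)))

include hG hw hint

theorem IsWeight.memLp_langevinUpdate :
    MemLp (fun s => w (langevinUpdate G h x s)) 2 (ν.prod (stdGaussian E)) :=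
  (memLp_two_iff_integrable_sq (hw.measurable.comp ((measurable_langevinUpdate hG h).comp
    measurable_prodMk_left)).aestronglyMeasurable).2 hint

variable {c : ℝ} {ψ : E → ℝ} (hψ : IsDominated w c ψ)

include hψ

theorem IsDominated.memLp_langevinUpdate :
    MemLp (fun s => ψ (langevinUpdate G h x s)) 2 (ν.prod (stdGaussian E)) :=
  ((hw.memLp_langevinUpdate hG hint).const_mul c).mono'
    (hψ.derivs.contDiff.continuous.measurable.comp ((measurable_langevinUpdate hG h).comp
      measurable_prodMk_left)).aestronglyMeasurable (.of_forall fun _ => hψ.abs_le _)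

variable [IsProbabilityMeasure ν]

theorem IsDominated.transitionOp_sub_generator_eq (hG_int : Integrable (G x) ν) :
    transitionOp (ν.prod (stdGaussian E)) (langevinUpdate G h) ψ x - ψ x
        - h * (1 / 2 * (fderiv ℝ ψ x (∫ b, G x b ∂ν) + Laplacian.laplacian ψ x))
      = ∫ b, (gaussianAvg ψ √h (x + (h / 2) • G x b) - ψ x
        - h / 2 * (fderiv ℝ ψ x (G x b) + Laplacian.laplacian ψ x)) ∂ν := by
  have hψ_int := (hψ.memLp_langevinUpdate hG hw hint).integrable one_le_two
  have havg : Integrable (fun b => gaussianAvg ψ √h (x + (h / 2) • G x b)) ν :=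
    hψ_int.integral_prod_left
  have hfderiv : Integrable (fun b => fderiv ℝ ψ x (G x b)) ν :=
    (fderiv ℝ ψ x).integrable_comp hG_int
  have hsub : Integrable (fun b => gaussianAvg ψ √h (x + (h / 2) • G x b) - ψ x) ν :=
    havg.sub (integrable_const _)
  have hgen : Integrable
      (fun b => h / 2 * (fderiv ℝ ψ x (G x b) + Laplacian.laplacian ψ x)) ν :=
    (hfderiv.add (integrable_const _)).const_mul _
  have htransition : transitionOp (ν.prod (stdGaussian E)) (langevinUpdate G h) ψ x
      = ∫ b, gaussianAvg ψ √h (x + (h / 2) • G x b) ∂ν := integral_prod _ hψ_int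
  rw [integral_sub hsub hgen, integral_sub havg (integrable_const _), integral_const_mul,
    integral_add hfderiv (integrable_const _), ContinuousLinearMap.integral_comp_comm _ hG_int,
    integral_const, integral_const, probReal_univ, one_smul, one_smul, htransition]
  ring

variable (hdom : ∀ b, IsDriftDominated w c ψ x (G x b)) (hh : 0 ≤ h)

include hdom hh

theorem IsDominated.abs_transitionOp_sub_generator_le (hG_int : Integrable (G x) ν) :
    |transitionOp (ν.prod (stdGaussian E)) (langevinUpdate G h) ψ x - ψ x
        - h * (1 / 2 * (fderiv ℝ ψ x (∫ b, G x b ∂ν) + Laplacian.laplacian ψ x))|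
      ≤ h ^ 2 * ((Module.finrank ℝ E + 1) * (c * ((1 + K) * (1 + 2 * K)
        * (w x + transitionOp (ν.prod (stdGaussian E)) (langevinUpdate G h) w x)))) := by
  have hw_int := (hw.memLp_langevinUpdate hG hint).integrable one_le_two
  have havg : Integrable (fun b => gaussianAvg w √h (x + (h / 2) • G x b)) ν :=
    hw_int.integral_prod_left
  have htransition : transitionOp (ν.prod (stdGaussian E)) (langevinUpdate G h) w x
      = ∫ b, gaussianAvg w √h (x + (h / 2) • G x b) ∂ν := integral_prod _ hw_int
  rw [hψ.transitionOp_sub_generator_eq hG hw hint hG_int, htransition, ← Real.norm_eq_abs]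
  have hbound : Integrable (fun b => h ^ 2 * ((Module.finrank ℝ E + 1) * (c * ((1 + K)
      * (1 + 2 * K) * (w x + gaussianAvg w √h (x + (h / 2) • G x b)))))) ν :=
    (((((integrable_const (w x)).add havg).const_mul _).const_mul c).const_mul _).const_mul _
  refine (norm_integral_le_of_norm_le hbound ?_).trans_eq ?_
  · filter_upwards [hw.ae_memLp_langevinUpdate hint] with b hb
    exact abs_gaussianAvg_langevinStep_sub_generator_le hw hψ (hdom b) hh hb
  · simp only [integral_const_mul]
    rw [integral_add (integrable_const _) havg, integral_const, probReal_univ, one_smul]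

theorem IsDominated.transitionOp_sub_generator_sq_le (hG_int : Integrable (G x) ν) :
    (transitionOp (ν.prod (stdGaussian E)) (langevinUpdate G h) ψ x - ψ x
        - h * (1 / 2 * (fderiv ℝ ψ x (∫ b, G x b ∂ν) + Laplacian.laplacian ψ x))) ^ 2
      ≤ h ^ 4 * (2 * ((Module.finrank ℝ E + 1) * (c * ((1 + K) * (1 + 2 * K)))) ^ 2
        * (w x ^ 2 + transitionOp (ν.prod (stdGaussian E)) (langevinUpdate G h)
          (fun y => w y ^ 2) x)) := by
  set M := (Module.finrank ℝ E + 1) * (c * ((1 + K) * (1 + 2 * K))) with hM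
  set A := transitionOp (ν.prod (stdGaussian E)) (langevinUpdate G h) w x
  set A₂ := transitionOp (ν.prod (stdGaussian E)) (langevinUpdate G h) (fun y => w y ^ 2) x
  have hA : A ^ 2 ≤ A₂ := sq_integral_le_integral_sq (hw.memLp_langevinUpdate hG hint)
  rw [← sq_abs]
  calc _ ≤ (h ^ 2 * ((Module.finrank ℝ E + 1) * (c * ((1 + K) * (1 + 2 * K) * (w x + A))))) ^ 2 :=
        pow_le_pow_left₀ (abs_nonneg _)
          (hψ.abs_transitionOp_sub_generator_le hG hw hint hdom hh hG_int) 2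
    _ = h ^ 4 * (M ^ 2 * (w x + A) ^ 2) := by
        rw [hM]
        ring
    _ ≤ h ^ 4 * (M ^ 2 * (2 * (w x ^ 2 + A₂))) := by
        grw [add_sq_le, hA]
    _ = h ^ 4 * (2 * M ^ 2 * (w x ^ 2 + A₂)) := by ring

theorem IsDominated.transitionOp_sub_sq_le (h1 : h ≤ 1) :
    transitionOp (ν.prod (stdGaussian E)) (langevinUpdate G h) (fun y => (ψ y - ψ x) ^ 2) x
      ≤ h * (((gaussianPoincareConst E).toReal * c ^ 2
          + 2 * ((Module.finrank ℝ E + 1) * (c * ((1 + K) * (1 + 2 * K)))) ^ 2)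
        * (w x ^ 2 + transitionOp (ν.prod (stdGaussian E)) (langevinUpdate G h)
          (fun y => w y ^ 2) x)) := by
  have hdiff_mem : MemLp (fun s => ψ (langevinUpdate G h x s) - ψ x) 2 (ν.prod (stdGaussian E)) :=
    (hψ.memLp_langevinUpdate hG hw hint).sub (memLp_const _)
  have hdiff := hdiff_mem.integrable_sq
  have havg : Integrable (fun b => gaussianAvg (fun z => w z ^ 2) √h (x + (h / 2) • G x b)) ν :=
    hint.integral_prod_left
  have htransition : transitionOp (ν.prod (stdGaussian E)) (langevinUpdate G h)
      (fun y => w y ^ 2) x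
      = ∫ b, gaussianAvg (fun z => w z ^ 2) √h (x + (h / 2) • G x b) ∂ν := integral_prod _ hint
  rw [htransition]
  calc _ = ∫ b, gaussianAvg (fun z => (ψ z - ψ x) ^ 2) √h (x + (h / 2) • G x b) ∂ν :=
        integral_prod _ hdiff
    _ ≤ _ := integral_mono_ae hdiff.integral_prod_left
        ((((integrable_const (w x ^ 2)).add havg).const_mul _).const_mul h) ?_
    _ = _ := by
        simp only [integral_const_mul, Pi.add_apply]
        rw [integral_add (integrable_const _) havg, integral_const, probReal_univ, one_smul]
  filter_upwards [hw.ae_memLp_langevinUpdate hint] with b hb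
  exact gaussianAvg_langevinStep_sub_sq_le hw hψ (hdom b) hh hb h1

end

section Poisson

variable {ν : Measure β} [IsProbabilityMeasure ν] {w : E → ℝ} {K c : ℝ} {ψ L : E → ℝ}

theorem IsDominated.isApproxPoisson (hG : Measurable (Function.uncurry G)) (hw : IsWeight w K)
    (hψ : IsDominated w c ψ) (hdom : ∀ x b, IsDriftDominated w c ψ x (G x b))
    (hG_int : ∀ x, Integrable (G x) ν)
    (hL : ∀ x, 1 / 2 * (fderiv ℝ ψ x (∫ b, G x b ∂ν) + Laplacian.laplacian ψ x) = L x)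
    (hL_meas : Measurable L) (hL_le : ∀ x, |L x| ≤ c * w x) (hh : 0 ≤ h) :
    IsApproxPoisson (ν.prod (stdGaussian E)) (langevinUpdate G h) (fun y => w y ^ 2)
      ((1 + (gaussianPoincareConst E).toReal) * c ^ 2
        + 2 * ((Module.finrank ℝ E + 1) * (c * ((1 + K) * (1 + 2 * K)))) ^ 2) h ψ L := by
  set p := (gaussianPoincareConst E).toReal
  set M := (Module.finrank ℝ E + 1) * (c * ((1 + K) * (1 + 2 * K)))
  have hp : 0 ≤ p := ENNReal.toReal_nonneg
  have hsq : c ^ 2 ≤ (1 + p) * c ^ 2 + 2 * M ^ 2 := by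
    nlinarith only [mul_nonneg hp (sq_nonneg c), sq_nonneg M]
  have hsq_le : ∀ {u : E → ℝ} (_ : ∀ x, |u x| ≤ c * w x) (x : E),
      u x ^ 2 ≤ ((1 + p) * c ^ 2 + 2 * M ^ 2) * w x ^ 2 := fun {u} hu x => by
    calc u x ^ 2 = |u x| ^ 2 := (sq_abs _).symm
      _ ≤ (c * w x) ^ 2 := pow_le_pow_left₀ (abs_nonneg _) (hu x) 2
      _ = c ^ 2 * w x ^ 2 := mul_pow _ _ _
      _ ≤ _ := by gcongr
  have hmean_nonneg : ∀ x, 0 ≤ w x ^ 2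
      + transitionOp (ν.prod (stdGaussian E)) (langevinUpdate G h) (fun y => w y ^ 2) x :=
    fun x => add_nonneg (sq_nonneg _) (integral_nonneg fun _ => sq_nonneg _)
  exact
    { measurable := hψ.derivs.contDiff.continuous.measurable
      measurable_rhs := hL_meas
      sq_le := hsq_le hψ.abs_le
      rhs_sq_le := hsq_le hL_le
      bias_sq_le := fun x hint => by
        rw [← hL x]
        refine (hψ.transitionOp_sub_generator_sq_le hG hw hint (hdom x) hh (hG_int x)).trans ?_
        have := hmean_nonneg x
        gcongr
        nlinarith only [mul_nonneg hp (sq_nonneg c), sq_nonneg c]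
      displacement_sq_le := fun h1 x hint => by
        refine (hψ.transitionOp_sub_sq_le hG hw hint (hdom x) hh h1).trans ?_
        have := hmean_nonneg x
        gcongr
        nlinarith only [sq_nonneg c] }

end Poisson

end RandomDrift

section Growth

theorem isWeight_one_add_rpow {E : Type*} [NormedAddCommGroup E] [NormedSpace ℝ E]
    [MeasurableSpace E] {Γ : E → ℝ} (hΓ : Measurable Γ) (hΓ_nonneg : ∀ x, 0 ≤ Γ x) {κ c : ℝ}
    (hκ : 0 ≤ κ)
    (hseg : ∀ x y : E, ∀ u ∈ Set.Ioo (0 : ℝ) 1,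
      Γ (u • x + (1 - u) • y) ^ κ ≤ c * (Γ x ^ κ + Γ y ^ κ)) :
    IsWeight (fun x => (1 + Γ x) ^ κ) (2 ^ κ * (1 + |c|)) where
  measurable := (hΓ.const_add 1).pow_const κ
  one_le x := Real.one_le_rpow (le_add_of_nonneg_right (hΓ_nonneg x)) hκ
  segment x y u hu := by
    have hone : ∀ z, 1 ≤ (1 + Γ z) ^ κ := fun z =>
      Real.one_le_rpow (le_add_of_nonneg_right (hΓ_nonneg z)) hκ
    have hconst : 1 ≤ 2 ^ κ * (1 + |c|) :=
      one_le_mul_of_one_le_of_one_le (Real.one_le_rpow one_le_two hκ)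
        (le_add_of_nonneg_right (abs_nonneg c))
    have hle : ∀ z, Γ z ^ κ ≤ (1 + Γ z) ^ κ := fun z =>
      Real.rpow_le_rpow (hΓ_nonneg z) (by linarith) hκ
    rcases eq_or_lt_of_le hu.1 with rfl | hu_pos
    · rw [zero_smul, sub_zero, one_smul, zero_add]
      nlinarith only [hone x, hone y, hconst]
    rcases eq_or_lt_of_le hu.2 with rfl | hu_lt
    · rw [sub_self, zero_smul, one_smul, add_zero]
      nlinarith only [hone x, hone y, hconst]
    calc (1 + Γ (u • x + (1 - u) • y)) ^ κ
        ≤ 2 ^ κ * (1 + Γ (u • x + (1 - u) • y) ^ κ) := one_add_rpow_le (hΓ_nonneg _) hκ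
      _ ≤ 2 ^ κ * (1 + |c| * (Γ x ^ κ + Γ y ^ κ)) := by
          have hx := Real.rpow_nonneg (hΓ_nonneg x) κ
          have hy := Real.rpow_nonneg (hΓ_nonneg y) κ
          grw [hseg x y u ⟨hu_pos, hu_lt⟩, ← le_abs_self c]
      _ ≤ 2 ^ κ * ((1 + Γ x) ^ κ + (1 + Γ y) ^ κ
            + |c| * ((1 + Γ x) ^ κ + (1 + Γ y) ^ κ)) := by
          have hsum : 1 ≤ (1 + Γ x) ^ κ + (1 + Γ y) ^ κ :=
            (hone x).trans (le_add_of_nonneg_right (zero_le_one.trans (hone y)))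
          refine mul_le_mul_of_nonneg_left (add_le_add hsum ?_) (by positivity)
          grw [hle x, hle y]
      _ = 2 ^ κ * (1 + |c|) * ((1 + Γ x) ^ κ + (1 + Γ y) ^ κ) := by ring

theorem isMomentBounded_one_add_rpow_sq {Ω E : Type*} [MeasurableSpace Ω] [MeasurableSpace E]
    {P : Measure Ω} [IsProbabilityMeasure P] {θ : ℕ → Ω → E} {Γ : E → ℝ} (hΓ : Measurable Γ)
    (hΓ_nonneg : ∀ x, 0 ≤ Γ x) {κ c : ℝ} (hκ : 0 ≤ κ) (hθ : ∀ t, Measurable (θ t))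
    (hint : ∀ t, Integrable (fun ω => Γ (θ t ω) ^ (2 * κ)) P)
    (hle : ∀ t, ∫ ω, Γ (θ t ω) ^ (2 * κ) ∂P ≤ c) :
    IsMomentBounded P θ (fun x => ((1 + Γ x) ^ κ) ^ 2) (2 ^ (2 * κ) * (1 + c)) := by
  have hmeas : Measurable (fun x => ((1 + Γ x) ^ κ) ^ 2) :=
    ((hΓ.const_add 1).pow_const κ).pow_const 2
  have hpointwise : ∀ x, ((1 + Γ x) ^ κ) ^ 2 ≤ 2 ^ (2 * κ) * (1 + Γ x ^ (2 * κ)) := fun x => by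
    rw [← Real.rpow_mul_natCast (by linarith [hΓ_nonneg x]), mul_comm κ, Nat.cast_ofNat]
    exact one_add_rpow_le (hΓ_nonneg x) (by positivity)
  have hbound : ∀ t, Integrable (fun ω => 2 ^ (2 * κ) * (1 + Γ (θ t ω) ^ (2 * κ))) P := fun t =>
    ((integrable_const 1).add (hint t)).const_mul _
  refine ⟨hmeas, fun t => ?_, fun t => ?_⟩
  · refine (hbound t).mono' (hmeas.comp (hθ t)).aestronglyMeasurable (.of_forall fun ω => ?_)
    rw [Real.norm_of_nonneg (sq_nonneg _)]
    exact hpointwise _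
  · refine (integral_mono_of_nonneg (.of_forall fun _ => sq_nonneg _) (hbound t)
      (.of_forall fun _ => hpointwise _)).trans ?_
    rw [integral_const_mul, integral_add (integrable_const 1) (hint t), integral_const,
      probReal_univ, one_smul]
    gcongr
    exact hle t

theorem exists_forall_le_mul_of_finite {ι E : Type*} [Finite ι] {F u : ι → E → ℝ} {v : E → ℝ}
    (hu : ∀ i x, 0 ≤ u i x) (huv : ∀ i x, u i x ≤ v x)
    (hF : ∀ i, ∃ c : ℝ, ∀ x, F i x ≤ c * u i x) :
    ∃ c : ℝ, 0 ≤ c ∧ ∀ i x, F i x ≤ c * v x := by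
  have := Fintype.ofFinite ι
  choose c hc using hF
  refine ⟨∑ i, |c i|, by positivity, fun i x => (hc i x).trans ?_⟩
  gcongr
  · exact hu i x
  · exact (le_abs_self _).trans
      (Finset.single_le_sum (f := fun i => |c i|) (fun _ _ => abs_nonneg _) (Finset.mem_univ i))
  · exact huv i x

end Growth

section PoissonGrowth

variable {E : Type*} [NormedAddCommGroup E] [InnerProductSpace ℝ E] [FiniteDimensional ℝ E]
  {f φ ψ : E → ℝ} {m₀ : ℝ}

section Equation

variable (hpoisson : ∀ x, 1 / 2 * inner ℝ (∇ f x) (∇ ψ x) + 1 / 2 * Laplacian.laplacian ψ x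
  = φ x - m₀)

include hpoisson

theorem laplacian_eq_of_poisson :
    Laplacian.laplacian ψ = fun x => (2 * φ x - 2 * m₀) - inner ℝ (∇ f x) (∇ ψ x) := by
  ext x
  linarith [hpoisson x]

theorem contDiff_laplacian_of_poisson (hf : ContDiff ℝ 3 f) (hφ : ContDiff ℝ 2 φ)
    (hψ : ContDiff ℝ 3 ψ) : ContDiff ℝ 2 (Laplacian.laplacian ψ) := by
  rw [laplacian_eq_of_poisson hpoisson]
  exact ((contDiff_const.mul hφ).sub contDiff_const).sub (contDiff_inner_gradient hf hψ)

theorem norm_iteratedFDeriv_two_laplacian_le_of_poisson (hf : ContDiff ℝ 3 f)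
    (hφ : ContDiff ℝ 2 φ) (hψ : ContDiff ℝ 3 ψ) {x : E} {a b : ℝ}
    (ha : ∀ j ∈ Finset.Icc 1 3, ‖iteratedFDeriv ℝ j f x‖ ≤ a)
    (hb : ∀ j ∈ Finset.Icc 1 3, ‖iteratedFDeriv ℝ j ψ x‖ ≤ b) :
    ‖iteratedFDeriv ℝ 2 (Laplacian.laplacian ψ) x‖
      ≤ 2 * ‖iteratedFDeriv ℝ 2 φ x‖ + Module.finrank ℝ E * (4 * (a * b)) := by
  have hφ2 : ContDiff ℝ 2 (fun x => (2 : ℝ) • φ x) := hφ.const_smul (2 : ℝ)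
  have hΔ : Laplacian.laplacian ψ
      = fun x => (fun x => (2 : ℝ) • φ x - 2 * m₀) x - inner ℝ (∇ f x) (∇ ψ x) :=
    laplacian_eq_of_poisson hpoisson
  rw [hΔ, fun_iteratedFDeriv_sub_apply (hφ2.sub contDiff_const).contDiffAt
      (contDiff_inner_gradient hf hψ).contDiffAt,
    fun_iteratedFDeriv_sub_apply hφ2.contDiffAt contDiff_const.contDiffAt,
    iteratedFDeriv_const_of_ne two_ne_zero, Pi.zero_apply, sub_zero,
    iteratedFDeriv_const_smul_apply' hφ.contDiffAt]
  refine (norm_sub_le _ _).trans ?_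
  rw [norm_smul, Real.norm_ofNat]
  gcongr
  exact norm_iteratedFDeriv_two_inner_gradient_le hf hψ ha hb

theorem abs_sub_le_of_poisson {x : E} {a b : ℝ} (ha : ‖iteratedFDeriv ℝ 1 f x‖ ≤ a)
    (hb : ∀ j ∈ Finset.Icc 1 2, ‖iteratedFDeriv ℝ j ψ x‖ ≤ b) :
    |φ x - m₀| ≤ a * b + Module.finrank ℝ E * b := by
  have hinner : |inner ℝ (∇ f x) (∇ ψ x)| ≤ a * b := by
    refine (abs_real_inner_le_norm _ _).trans ?_
    rw [norm_gradient, norm_gradient, ← norm_iteratedFDeriv_one, ← norm_iteratedFDeriv_one]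
    exact mul_le_mul ha (hb 1 (by simp)) (norm_nonneg _) ((norm_nonneg _).trans ha)
  have hlap : |Laplacian.laplacian ψ x| ≤ Module.finrank ℝ E * b := by
    refine (norm_laplacian_le ψ x).trans ?_
    gcongr
    exact hb 2 (by simp)
  rw [← hpoisson x]
  rw [abs_le] at hinner hlap ⊢
  constructor <;> linarith only [hinner.1, hinner.2, hlap.1, hlap.2]

end Equation

variable {Λ : E → ℝ} {a r b g α e : ℝ} (hΛ : ∀ x, 1 ≤ Λ x) (ha : 0 ≤ a) (hr : 0 ≤ r)
  (hψ : ContDiff ℝ 3 ψ) (hψ_le : ∀ j < 4, ∀ x, ‖iteratedFDeriv ℝ j ψ x‖ ≤ b * Λ x ^ a)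
  (hf : ContDiff ℝ 3 f)
  (hf_le : ∀ j ∈ Finset.Icc 1 3, ∀ x, ‖iteratedFDeriv ℝ j f x‖ ≤ α * Λ x ^ r)
  (hpoisson : ∀ x, 1 / 2 * inner ℝ (∇ f x) (∇ ψ x) + 1 / 2 * Laplacian.laplacian ψ x = φ x - m₀)

include hΛ hr hψ_le hf_le hpoisson in
theorem abs_sub_le_mul_rpow_of_poisson (hα : 0 ≤ α) (x : E) :
    |φ x - m₀| ≤ (α * b + Module.finrank ℝ E * b) * Λ x ^ (a + 2 * r) := by
  have hpos : 0 < Λ x := zero_lt_one.trans_le (hΛ x)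
  have hb : 0 ≤ b := nonneg_of_mul_nonneg_left
    ((norm_nonneg _).trans (hψ_le 0 (by norm_num) x)) (Real.rpow_pos_of_pos hpos a)
  have hmul : Λ x ^ r * Λ x ^ a ≤ Λ x ^ (a + 2 * r) := by
    rw [← Real.rpow_add hpos]
    exact Real.rpow_le_rpow_of_exponent_le (hΛ x) (by linarith)
  have hself : Λ x ^ a ≤ Λ x ^ (a + 2 * r) :=
    Real.rpow_le_rpow_of_exponent_le (hΛ x) (by linarith)
  calc |φ x - m₀| ≤ α * Λ x ^ r * (b * Λ x ^ a) + Module.finrank ℝ E * (b * Λ x ^ a) :=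
        abs_sub_le_of_poisson hpoisson (hf_le 1 (by simp) x) fun j hj =>
          hψ_le j (by have := Finset.mem_Icc.1 hj; lia) x
    _ = α * b * (Λ x ^ r * Λ x ^ a) + Module.finrank ℝ E * b * Λ x ^ a := by ring
    _ ≤ α * b * Λ x ^ (a + 2 * r) + Module.finrank ℝ E * b * Λ x ^ (a + 2 * r) := by
        grw [hmul, hself]
    _ = (α * b + Module.finrank ℝ E * b) * Λ x ^ (a + 2 * r) := by ring

include hψ hψ_le in
theorem norm_fderiv_laplacian_le_mul_rpow (x : E) :
    ‖fderiv ℝ (Laplacian.laplacian ψ) x‖ ≤ Module.finrank ℝ E * b * Λ x ^ a := by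
  refine (norm_fderiv_laplacian_le hψ x).trans ?_
  rw [mul_assoc]
  gcongr
  exact hψ_le 3 (by norm_num) x

include hΛ ha hr hψ hψ_le in
theorem isDriftDominated_of_norm_le_mul_rpow (hg : 0 ≤ g) {x G : E} (hG : ‖G‖ ≤ g * Λ x ^ r) :
    IsDriftDominated (fun x => Λ x ^ (a + 2 * r))
      (b * g + b * g ^ 2 + Module.finrank ℝ E * b * g) ψ x G := by
  have hpos : ∀ z, 0 < Λ z := fun z => zero_lt_one.trans_le (hΛ z)
  have hb : 0 ≤ b := nonneg_of_mul_nonneg_left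
    ((norm_nonneg _).trans (hψ_le 0 (by norm_num) x)) (Real.rpow_pos_of_pos (hpos x) a)
  have hsum : ∀ z, 0 ≤ Λ z ^ (a + 2 * r) + Λ x ^ (a + 2 * r) := fun z => by
    have := hpos z
    have := hpos x
    positivity
  have hG_sq : ‖G‖ ^ 2 ≤ g ^ 2 * Λ x ^ (2 * r) := by
    refine (pow_le_pow_left₀ (norm_nonneg _) hG 2).trans_eq ?_
    rw [mul_pow, ← Real.rpow_mul_natCast (hpos x).le, mul_comm r, Nat.cast_ofNat]
  have hprod : ∀ {A B M N s : ℝ} {z : E}, 0 ≤ B → 0 ≤ M → 0 ≤ N → 0 ≤ s → s ≤ 2 * r →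
      A ≤ M * Λ z ^ a → B ≤ N * Λ x ^ s →
      M * N ≤ b * g + b * g ^ 2 + Module.finrank ℝ E * b * g →
      A * B ≤ (b * g + b * g ^ 2 + Module.finrank ℝ E * b * g)
        * (Λ z ^ (a + 2 * r) + Λ x ^ (a + 2 * r)) :=
    fun {A B M N s z} hB hM hN hs hsr hAM hBN hMN => by
      have := hpos z
      calc A * B ≤ (M * Λ z ^ a) * (N * Λ x ^ s) := mul_le_mul hAM hBN hB (by positivity)
        _ = M * N * (Λ z ^ a * Λ x ^ s) := by ring
        _ ≤ M * N * (Λ z ^ (a + 2 * r) + Λ x ^ (a + 2 * r)) := by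
            gcongr
            exact rpow_mul_rpow_le_add (hΛ z) (hΛ x) ha hs (by linarith)
        _ ≤ _ := mul_le_mul_of_nonneg_right hMN (hsum z)
  have h₁ : 0 ≤ b * g := by positivity
  have h₂ : 0 ≤ b * g ^ 2 := by positivity
  have h₃ : 0 ≤ Module.finrank ℝ E * b * g := by positivity
  refine ⟨fun z => ?_, fun z => ?_, fun z => ?_⟩
  · rw [← norm_iteratedFDeriv_one]
    exact hprod (norm_nonneg _) hb hg hr (by linarith) (hψ_le 1 (by norm_num) z) hG (by linarith)
  · exact hprod (sq_nonneg _) hb (sq_nonneg g) (by positivity) le_rfl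
      (hψ_le 2 (by norm_num) z) hG_sq (by linarith)
  · exact hprod (norm_nonneg _) (by positivity) hg hr (by linarith)
      (norm_fderiv_laplacian_le_mul_rpow hψ hψ_le z) hG (by linarith)

include hΛ hr hψ hψ_le hf hf_le hpoisson

theorem isDominated_of_poisson (hα : 0 ≤ α) (he : 0 ≤ e) (hφ : ContDiff ℝ 2 φ)
    (hφ_le : ∀ x, ‖iteratedFDeriv ℝ 2 φ x‖ ≤ e * Λ x ^ a) :
    IsDominated (fun x => Λ x ^ (a + 2 * r))
      (b + Module.finrank ℝ E * b + (2 * e + Module.finrank ℝ E * (4 * (α * b)))) ψ := by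
  set n : ℝ := (Module.finrank ℝ E : ℝ)
  have hn : 0 ≤ n := Nat.cast_nonneg _
  have hpos : ∀ x, 0 < Λ x := fun x => zero_lt_one.trans_le (hΛ x)
  have hb : 0 ≤ b := nonneg_of_mul_nonneg_left
    ((norm_nonneg _).trans (hψ_le 0 (by norm_num) 0)) (Real.rpow_pos_of_pos (hpos 0) a)
  have hnb : 0 ≤ n * b := mul_nonneg hn hb
  have hsecond : 0 ≤ 2 * e + n * (4 * (α * b)) := by positivity
  have hmono : ∀ {A M s : ℝ} {x : E}, A ≤ M * Λ x ^ s → s ≤ a + 2 * r →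
      M ≤ b + n * b + (2 * e + n * (4 * (α * b))) →
      A ≤ (b + n * b + (2 * e + n * (4 * (α * b)))) * Λ x ^ (a + 2 * r) :=
    fun {A M s x} hA hs hM => hA.trans (mul_le_mul hM
      (Real.rpow_le_rpow_of_exponent_le (hΛ x) hs) (Real.rpow_nonneg (hpos x).le _)
      (by positivity))
  have hj : ∀ j < 4, ∀ x, ‖iteratedFDeriv ℝ j ψ x‖
      ≤ (b + n * b + (2 * e + n * (4 * (α * b)))) * Λ x ^ (a + 2 * r) :=
    fun j hj x => hmono (hψ_le j hj x) (by linarith) (by linarith)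
  refine ⟨fun x => ?_, ⟨hψ.of_le (by norm_num), fun x => ?_, hj 2 (by norm_num)⟩,
    contDiff_laplacian_of_poisson hpoisson hf hφ hψ, fun x => ?_, fun x => ?_⟩
  · rw [← Real.norm_eq_abs, ← norm_iteratedFDeriv_zero (𝕜 := ℝ)]
    exact hj 0 (by norm_num) x
  · rw [← norm_iteratedFDeriv_one]
    exact hj 1 (by norm_num) x
  · exact hmono (norm_fderiv_laplacian_le_mul_rpow hψ hψ_le x) (by linarith) (by linarith)
  · refine hmono (M := 2 * e + n * (4 * (α * b))) (s := a + r) ?_ (by linarith) (by linarith)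
    calc ‖iteratedFDeriv ℝ 2 (Laplacian.laplacian ψ) x‖
        ≤ 2 * ‖iteratedFDeriv ℝ 2 φ x‖ + n * (4 * (α * Λ x ^ r * (b * Λ x ^ a))) :=
          norm_iteratedFDeriv_two_laplacian_le_of_poisson hpoisson hf hφ hψ
            (fun j hj => hf_le j hj x) fun j hj =>
              hψ_le j (by have := Finset.mem_Icc.1 hj; lia) x
      _ ≤ 2 * (e * Λ x ^ (a + r)) + n * (4 * (α * Λ x ^ r * (b * Λ x ^ a))) := by
          gcongr
          exact (hφ_le x).trans (mul_le_mul_of_nonneg_left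
            (Real.rpow_le_rpow_of_exponent_le (hΛ x) (le_add_of_nonneg_right hr)) he)
      _ = (2 * e + n * (4 * (α * b))) * Λ x ^ (a + r) := by
          rw [Real.rpow_add (hpos x)]
          ring

include ha in
theorem exists_isApproxPoisson_langevinUpdate [MeasurableSpace E] [BorelSpace E] {β : Type*}
    [MeasurableSpace β] {ν : Measure β} [IsProbabilityMeasure ν] {K : ℝ}
    (hw : IsWeight (fun x => Λ x ^ (a + 2 * r)) K) (hα : 0 ≤ α) (he : 0 ≤ e)
    (hφ : ContDiff ℝ 2 φ) (hφ_le : ∀ x, ‖iteratedFDeriv ℝ 2 φ x‖ ≤ e * Λ x ^ a)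
    {G : E → β → E} (hG : Measurable (Function.uncurry G)) (hg : 0 ≤ g)
    (hG_le : ∀ x b, ‖G x b‖ ≤ g * Λ x ^ r) (hG_mean : ∀ x, ∫ b, G x b ∂ν = ∇ f x) :
    ∃ C, 0 ≤ C ∧ ∀ h, 0 ≤ h → IsApproxPoisson (ν.prod (stdGaussian E)) (langevinUpdate G h)
      (fun y => (Λ y ^ (a + 2 * r)) ^ 2) C h ψ (fun x => φ x - m₀) := by
  have hweight : ∀ x, 0 ≤ Λ x ^ (a + 2 * r) := hw.nonneg
  obtain ⟨c, hdom, hdrift, hrhs⟩ : ∃ c, IsDominated (fun x => Λ x ^ (a + 2 * r)) c ψ ∧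
      (∀ x b, IsDriftDominated (fun x => Λ x ^ (a + 2 * r)) c ψ x (G x b)) ∧
      ∀ x, |φ x - m₀| ≤ c * Λ x ^ (a + 2 * r) := by
    have hdom := isDominated_of_poisson hΛ hr hψ hψ_le hf hf_le hpoisson hα he hφ hφ_le
    have hdrift := fun x b =>
      isDriftDominated_of_norm_le_mul_rpow hΛ ha hr hψ hψ_le hg (hG_le x b)
    have hrhs := abs_sub_le_mul_rpow_of_poisson hΛ hr hψ_le hf_le hpoisson hα
    exact ⟨_, hdom.mono hweight ((le_max_left _ _).trans (le_max_left _ _)),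
      fun x b => (hdrift x b).mono hweight ((le_max_right _ _).trans (le_max_left _ _)),
      fun x => (hrhs x).trans (mul_le_mul_of_nonneg_right (le_max_right _ _) (hweight x))⟩
  refine ⟨_, ?_, fun h hh => hdom.isApproxPoisson hG hw hdrift
    (fun x => .of_bound (by fun_prop) (g * Λ x ^ r) (.of_forall fun b => hG_le x b)) (fun x => ?_)
    (hφ.continuous.measurable.sub_const m₀) hrhs hh⟩
  · have := ENNReal.toReal_nonneg (a := gaussianPoincareConst E)
    positivity
  · rw [hG_mean, ← hpoisson, inner_gradient_right, conj_trivial, mul_add]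

end PoissonGrowth

section WeakError

theorem rpow_le_one_add_rpow {x s κ : ℝ} (hx : 0 ≤ x) (hs : 0 ≤ s) (hsκ : s ≤ κ) :
    x ^ s ≤ (1 + x) ^ κ :=
  (Real.rpow_le_rpow hx (le_add_of_nonneg_left zero_le_one) hs).trans
    (Real.rpow_le_rpow_of_exponent_le (le_add_of_nonneg_right hx) hsκ)

theorem one_add_rpow_le_two_mul {x s κ : ℝ} (hx : 0 ≤ x) (hs : 0 ≤ s) (hsκ : s ≤ κ) :
    1 + x ^ s ≤ 2 * (1 + x) ^ κ := by
  rw [two_mul]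
  exact add_le_add (Real.one_le_rpow (le_add_of_nonneg_right hx) (hs.trans hsκ))
    (rpow_le_one_add_rpow hx hs hsκ)

theorem mcAverage_sub_eq {Ω E : Type*} (φ : E → ℝ) (θ : ℕ → Ω → E) {T : ℕ} (hT : 0 < T) (m₀ : ℝ)
    (ω : Ω) :
    mcAverage φ θ T ω - m₀ = (T : ℝ)⁻¹ * ∑ t ∈ Finset.range T, (φ (θ (t + 1) ω) - m₀) := by
  have hT' : (T : ℝ) ≠ 0 := Nat.cast_ne_zero.2 hT.ne'
  rw [mcAverage, Finset.range_eq_Ico, Finset.sum_Ico_add' (fun t => φ (θ t ω) - m₀) 0 T 1,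
    zero_add, Finset.Ico_add_one_right_eq_Icc, Finset.sum_sub_distrib, Finset.sum_const,
    Nat.card_Icc, Nat.add_sub_cancel, nsmul_eq_mul, mul_sub, inv_mul_cancel_left₀ hT']

variable {E : Type*} [NormedAddCommGroup E] [InnerProductSpace ℝ E] [FiniteDimensional ℝ E]
  [MeasurableSpace E] [BorelSpace E] {β : Type*} [MeasurableSpace β] {ν : Measure β}
  [IsProbabilityMeasure ν] {f φ ψ Γ : E → ℝ} {m₀ r g₀ : ℝ} {p : Fin 4 → ℝ} {G : E → β → E}
  (hf : ContDiff ℝ 3 f) (hφ : ContDiff ℝ 2 φ) (hψ : ContDiff ℝ 3 ψ)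
  (hpoisson : ∀ x, 1 / 2 * inner ℝ (∇ f x) (∇ ψ x) + 1 / 2 * Laplacian.laplacian ψ x = φ x - m₀)
  (hΓ : Measurable Γ) (hΓ_nonneg : ∀ x, 0 ≤ Γ x) (hp : ∀ k, 0 ≤ p k) (hr : 0 ≤ r)
  (hψ_growth : ∀ k : Fin 4, ∃ c : ℝ, ∀ x, ‖iteratedFDeriv ℝ k ψ x‖ ≤ c * Γ x ^ p k)
  (hφ_growth : ∃ (k : Fin 4) (c : ℝ), ∀ x, ‖iteratedFDeriv ℝ 2 φ x‖ ≤ c * (1 + Γ x ^ p k))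
  (hf_growth : ∀ j ∈ Finset.Icc 1 3, ∃ c : ℝ, ∀ x, ‖iteratedFDeriv ℝ j f x‖ ≤ c * (1 + Γ x ^ r))
  (hG : Measurable (Function.uncurry G)) (hG_mean : ∀ x, ∫ b, G x b ∂ν = ∇ f x)
  (hG_le : ∀ x b, ‖G x b‖ ≤ ‖∇ f x‖ + g₀)

include hf hφ hψ hpoisson hΓ hΓ_nonneg hp hr hψ_growth hφ_growth hf_growth hG hG_mean hG_le

theorem exists_isApproxPoisson_of_growth {a : ℝ} (hpa : ∀ k, p k ≤ a)
    (hΓ_segment : ∃ c : ℝ, ∀ x y : E, ∀ u ∈ Set.Ioo (0 : ℝ) 1,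
      Γ (u • x + (1 - u) • y) ^ (a + 2 * r)
        ≤ c * (Γ x ^ (a + 2 * r) + Γ y ^ (a + 2 * r))) :
    ∃ C, 0 ≤ C ∧ ∀ h, 0 ≤ h → IsApproxPoisson (ν.prod (stdGaussian E)) (langevinUpdate G h)
      (fun x => ((1 + Γ x) ^ (a + 2 * r)) ^ 2) C h ψ (fun x => φ x - m₀) := by
  have ha : 0 ≤ a := (hp 0).trans (hpa 0)
  have hΛ : ∀ x, 1 ≤ 1 + Γ x := fun x => le_add_of_nonneg_right (hΓ_nonneg x)
  obtain ⟨c, hseg⟩ := hΓ_segment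
  obtain ⟨b, -, hb⟩ := exists_forall_le_mul_of_finite (v := fun x => (1 + Γ x) ^ a)
    (fun k x => Real.rpow_nonneg (hΓ_nonneg x) (p k))
    (fun k x => rpow_le_one_add_rpow (hΓ_nonneg x) (hp k) (hpa k)) hψ_growth
  obtain ⟨α, hα, hf_le⟩ := exists_forall_le_mul_of_finite (ι := Finset.Icc 1 3)
    (v := fun x => 2 * (1 + Γ x) ^ r) (u := fun _ x => 1 + Γ x ^ r)
    (fun _ x => add_nonneg zero_le_one (Real.rpow_nonneg (hΓ_nonneg x) r))
    (fun _ x => one_add_rpow_le_two_mul (hΓ_nonneg x) hr le_rfl) fun j => hf_growth j j.2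
  obtain ⟨k, hφ_growth⟩ := hφ_growth
  obtain ⟨e, he, hφ_le⟩ := exists_forall_le_mul_of_finite (ι := Unit)
    (v := fun x => 2 * (1 + Γ x) ^ a) (u := fun _ x => 1 + Γ x ^ p k)
    (fun _ x => add_nonneg zero_le_one (Real.rpow_nonneg (hΓ_nonneg x) (p k)))
    (fun _ x => one_add_rpow_le_two_mul (hΓ_nonneg x) (hp k) (hpa k)) fun _ => hφ_growth
  have hf_le' : ∀ j ∈ Finset.Icc 1 3, ∀ x,
      ‖iteratedFDeriv ℝ j f x‖ ≤ α * 2 * (1 + Γ x) ^ r := fun j hj x =>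
    (hf_le ⟨j, hj⟩ x).trans_eq (mul_assoc _ _ _).symm
  have hdrift_le : ∀ x b, ‖G x b‖ ≤ (α * 2 + |g₀|) * (1 + Γ x) ^ r := fun x b => by
    have hgrad : ‖∇ f x‖ ≤ α * 2 * (1 + Γ x) ^ r := by
      rw [norm_gradient, ← norm_iteratedFDeriv_one]
      exact hf_le' 1 (by simp) x
    have hconst : g₀ ≤ |g₀| * (1 + Γ x) ^ r :=
      (le_abs_self g₀).trans (le_mul_of_one_le_right (abs_nonneg _) (Real.one_le_rpow (hΛ x) hr))
    linarith [hG_le x b]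
  exact exists_isApproxPoisson_langevinUpdate hΛ ha hr hψ (fun j hj x => hb ⟨j, hj⟩ x) hf hf_le'
    hpoisson (isWeight_one_add_rpow hΓ hΓ_nonneg (by positivity) hseg) (by positivity)
    (by positivity) hφ (fun x => (hφ_le () x).trans_eq (mul_assoc _ _ _).symm) hG (by positivity)
    hdrift_le hG_mean

theorem exists_integral_mcAverage_sub_sq_le {Ω : Type*} [mΩ : MeasurableSpace Ω] {P : Measure Ω}
    [IsProbabilityMeasure P] {𝓕 : Filtration ℕ mΩ} {z : ℕ → Ω → β × E} {H : Set ℝ}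
    (hH : ∀ h ∈ H, 0 < h) {θ : ℝ → ℕ → Ω → E}
    (hθ : ∀ h ∈ H,
      IsNoiseDriven P (ν.prod (stdGaussian E)) (langevinUpdate G h) 𝓕 (θ h) z)
    (hΓ_moment : ∀ k, ∃ c : ℝ, ∀ h ∈ H, ∀ t,
      Integrable (fun ω => Γ (θ h t ω) ^ (2 * (p k + 2 * r))) P ∧
      ∫ ω, Γ (θ h t ω) ^ (2 * (p k + 2 * r)) ∂P ≤ c)
    (hΓ_segment : ∀ k, ∃ c : ℝ, ∀ x y : E, ∀ u ∈ Set.Ioo (0 : ℝ) 1,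
      Γ (u • x + (1 - u) • y) ^ (p k + 2 * r)
        ≤ c * (Γ x ^ (p k + 2 * r) + Γ y ^ (p k + 2 * r))) :
    ∃ C : ℝ, 0 ≤ C ∧ ∀ h ∈ H, ∀ T : ℕ, 0 < T →
      Integrable (fun ω => (mcAverage φ (θ h) T ω - m₀) ^ 2) P ∧
      ∫ ω, (mcAverage φ (θ h) T ω - m₀) ^ 2 ∂P ≤ C * (1 / (h * T) + h ^ 2) := by
  obtain ⟨k, hk⟩ := Finite.exists_max p
  obtain ⟨C, hC, hPoisson⟩ := exists_isApproxPoisson_of_growth hf hφ hψ hpoisson hΓ hΓ_nonneg hp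
    hr hψ_growth hφ_growth hf_growth hG hG_mean hG_le hk (hΓ_segment k)
  obtain ⟨c, hmoment⟩ := hΓ_moment k
  set K := 2 ^ (2 * (p k + 2 * r)) * (1 + |c|)
  refine ⟨16 * (C * K), by positivity, fun h hh T hT => ?_⟩
  have hv : IsMomentBounded P (θ h) (fun x => ((1 + Γ x) ^ (p k + 2 * r)) ^ 2) K :=
    isMomentBounded_one_add_rpow_sq hΓ hΓ_nonneg (add_nonneg (hp k) (by positivity))
      (hθ h hh).measurable_chain (fun t => (hmoment h hh t).1)
      fun t => (hmoment h hh t).2.trans (le_abs_self c)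
  have hP := hPoisson h (hH h hh).le
  simp_rw [mcAverage_sub_eq φ (θ h) hT]
  exact ⟨(hv.memLp_average hP.measurable_rhs hP.rhs_sq_le (hθ h hh).measurable_chain
    T).integrable_sq, (hθ h hh).integral_average_sq_le hv hP hC (hH h hh) hT⟩

end WeakError

theorem indepFun_prodMk_left {Ω α β γ : Type*} [MeasurableSpace Ω] [MeasurableSpace α]
    [MeasurableSpace β] [MeasurableSpace γ] {P : Measure Ω} [IsProbabilityMeasure P] {X : Ω → α}
    {Y : Ω → β} {Z : Ω → γ} (hX : Measurable X) (hY : Measurable Y) (hZ : Measurable Z)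
    (hX_YZ : IndepFun X (fun ω => (Y ω, Z ω)) P) (hYZ : IndepFun Y Z P) :
    IndepFun (fun ω => (X ω, Y ω)) Z P := by
  have hXY : IndepFun X Y P := hX_YZ.comp measurable_id measurable_fst
  rw [indepFun_iff_map_prod_eq_prod_map_map (by fun_prop) (by fun_prop)] at hX_YZ hYZ hXY ⊢
  have := Measure.isProbabilityMeasure_map (μ := P) hX.aemeasurable
  have := Measure.isProbabilityMeasure_map (μ := P) hY.aemeasurable
  have := Measure.isProbabilityMeasure_map (μ := P) hZ.aemeasurable
  have hassoc : P.map (fun ω => ((X ω, Y ω), Z ω))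
      = (P.map (fun ω => (X ω, (Y ω, Z ω)))).map MeasurableEquiv.prodAssoc.symm := by
    rw [Measure.map_map (by fun_prop) (by fun_prop)]
    rfl
  rw [hassoc, hX_YZ, hYZ, hXY, ← Measure.prodAssoc_prod,
    Measure.map_map (by fun_prop) (by fun_prop), MeasurableEquiv.symm_comp_self, Measure.map_id]

namespace FederatedModel

variable {X : Type*} {d S : ℕ} (M : FederatedModel X d S)

section Gradient

theorem differentiableAt_log_lik (s : Fin S) (i : Fin (M.N s)) (θ : Param d) :
    DifferentiableAt ℝ (fun η => Real.log (M.lik (M.x s i) η)) θ :=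
  (M.lik_diff s i θ).log (M.lik_pos s i θ).ne'

theorem logPost_eq_add_sum (θ : Param d) :
    M.logPost θ = Real.log (M.prior θ) + ∑ s, ∑ i, Real.log (M.lik (M.x s i) θ) := by
  have hlik : ∀ s, ∏ i, M.lik (M.x s i) θ ≠ 0 := fun s =>
    Finset.prod_ne_zero_iff.2 fun i _ => (M.lik_pos s i θ).ne'
  rw [logPost, post, Real.log_mul (M.prior_pos θ).ne' (Finset.prod_ne_zero_iff.2 fun s _ => hlik s),
    Real.log_prod fun s _ => hlik s]
  exact congrArg _ (Finset.sum_congr rfl fun s _ => Real.log_prod fun i _ => (M.lik_pos s i θ).ne')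

theorem gradient_logPost (θ : Param d) :
    ∇ M.logPost θ = ∇ (fun η => Real.log (M.prior η)) θ + ∑ s, ∑ i, M.gradLik s i θ := by
  have hprior : DifferentiableAt ℝ (fun η => Real.log (M.prior η)) θ :=
    (M.prior_diff θ).log (M.prior_pos θ).ne'
  have hshard : ∀ s, HasGradientAt (fun η => ∑ i, Real.log (M.lik (M.x s i) η))
      (∑ i, M.gradLik s i θ) θ := fun s =>
    hasGradientAt_sum fun i _ => M.differentiableAt_log_lik s i θ
  have hlik : HasGradientAt (fun η => ∑ s, ∑ i, Real.log (M.lik (M.x s i) η))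
      (∑ s, ∇ (fun η => ∑ i, Real.log (M.lik (M.x s i) η)) θ) θ :=
    hasGradientAt_sum fun s _ => (hshard s).differentiableAt
  simp_rw [funext M.logPost_eq_add_sum, ← fun s => (hshard s).gradient]
  refine HasGradientAt.gradient ?_
  rw [hasGradientAt_iff_hasFDerivAt, map_add]
  exact hprior.hasGradientAt.hasFDerivAt.add hlik.hasFDerivAt

theorem gradient_log_prod_surrogate (θ : Param d) :
    ∇ (fun η => Real.log (∏ s, M.q s η)) θ = ∑ s, M.gradSurr s θ := by
  simp_rw [fun η => Real.log_prod fun s (_ : s ∈ Finset.univ) => (M.q_pos s η).ne']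
  exact (hasGradientAt_sum fun s _ => (M.q_diff s θ).log (M.q_pos s θ).ne').gradient

end Gradient

section Batch

variable {m : ℕ}

instance : DiscreteMeasurableSpace (M.Batch m) where
  forall_measurableSet s := MeasurableSpace.measurableSet_iInf.2 fun a =>
    (MeasurableSet.of_discrete : MeasurableSet (Sigma.mk a ⁻¹' s))

theorem batchPMF_apply (s : Fin S) (i : Fin m → Fin (M.N s)) :
    M.batchPMF m ⟨s, i⟩ = M.f s * ((M.N s : ENNReal) ^ m)⁻¹ := by
  rw [batchPMF, PMF.bind_apply, tsum_eq_single s]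
  · rw [PMF.map_apply, tsum_eq_single i, if_pos rfl, PMF.uniformOfFintype_apply, Fintype.card_fun,
      Fintype.card_fin, Fintype.card_fin, Nat.cast_pow]
    exact fun j hj => if_neg fun hij => hj (sigma_mk_injective hij).symm
  · intro s' hs'
    rw [PMF.map_apply, ENNReal.tsum_eq_zero.2, mul_zero]
    exact fun j => if_neg fun hij => hs' (congrArg Sigma.fst hij).symm

theorem prob_pos (s : Fin S) : 0 < M.prob s :=
  ENNReal.toReal_pos (M.f_ne_zero s) (M.f.apply_ne_top s)

theorem sum_prob : ∑ s, M.prob s = 1 := by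
  have hsum : ∑ s, M.f s = 1 := (tsum_fintype _).symm.trans M.f.tsum_coe
  simp_rw [prob]
  rw [← ENNReal.toReal_sum fun s _ => M.f.apply_ne_top s, hsum, ENNReal.toReal_one]

theorem integral_batchPMF {F : Type*} [NormedAddCommGroup F] [NormedSpace ℝ F] [CompleteSpace F]
    (V : M.Batch m → F) :
    ∫ b, V b ∂(M.batchPMF m).toMeasure
      = ∑ s, M.prob s • (((M.N s : ℝ) ^ m)⁻¹ • ∑ i, V ⟨s, i⟩) := by
  rw [PMF.integral_eq_sum, Fintype.sum_sigma]
  refine Finset.sum_congr rfl fun s _ => ?_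
  rw [Finset.smul_sum, Finset.smul_sum]
  refine Finset.sum_congr rfl fun i _ => ?_
  rw [batchPMF_apply, ENNReal.toReal_mul, ENNReal.toReal_inv, ENNReal.toReal_pow,
    ENNReal.toReal_natCast, mul_smul, prob]

/-- The stochastic drift of CG-DSGLD: the estimate of `∇ log π(θ)` computed from the
mini-batch `b`. -/
noncomputable def drift (θ : Param d) (b : M.Batch m) : Param d :=
  M.dsgldGrad b θ + M.conduciveGrad b.1 θ

theorem sum_batch_gradLik (s : Fin S) (θ : Param d) :
    ∑ i : Fin m → Fin (M.N s), ∑ j, M.gradLik s (i j) θ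
      = ((m : ℝ) * (M.N s : ℝ) ^ (m - 1)) • ∑ k, M.gradLik s k θ := by
  have hcoord : ∀ j : Fin m, ∑ i : Fin m → Fin (M.N s), M.gradLik s (i j) θ
      = ((M.N s : ℝ) ^ (m - 1)) • ∑ k, M.gradLik s k θ := fun j => by
    rw [← Fintype.piFinset_univ, Fintype.sum_piFinset_apply (fun k => M.gradLik s k θ),
      Finset.card_univ, Fintype.card_fin, Fintype.card_fin, ← Nat.cast_smul_eq_nsmul ℝ,
      Nat.cast_pow]
  simp_rw [Finset.sum_comm (s := Finset.univ (α := Fin m → Fin (M.N s))), hcoord]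
  rw [Finset.sum_const, Finset.card_univ, Fintype.card_fin, ← Nat.cast_smul_eq_nsmul ℝ, smul_smul]

theorem prob_smul_average_drift (hm : 0 < m) (s : Fin S) (θ : Param d) :
    M.prob s • (((M.N s : ℝ) ^ m)⁻¹ • ∑ i, M.drift θ (⟨s, i⟩ : M.Batch m))
      = M.prob s • (∇ (fun η => Real.log (M.prior η)) θ + ∑ s', M.gradSurr s' θ)
        + (∑ i, M.gradLik s i θ - M.gradSurr s θ) := by
  have hprob := (M.prob_pos s).ne'
  have hN : (M.N s : ℝ) ≠ 0 := Nat.cast_ne_zero.2 (M.N_pos s).ne'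
  have hm' : (m : ℝ) ≠ 0 := Nat.cast_ne_zero.2 hm.ne'
  have hN_pow : (M.N s : ℝ) ^ (m - 1) ≠ 0 := pow_ne_zero _ hN
  simp only [drift, dsgldGrad, conduciveGrad, gradient_log_prod_surrogate, Finset.sum_add_distrib,
    ← Finset.smul_sum, sum_batch_gradLik M, Finset.sum_const, Finset.card_univ, Fintype.card_fun,
    Fintype.card_fin, ← Nat.cast_smul_eq_nsmul ℝ, ← mul_pow_sub_one hm.ne']
  match_scalars <;> field_simp

theorem integral_drift (hm : 0 < m) (θ : Param d) :
    ∫ b, M.drift θ b ∂(M.batchPMF m).toMeasure = ∇ M.logPost θ := by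
  simp_rw [integral_batchPMF, gradient_logPost, M.prob_smul_average_drift hm]
  rw [Finset.sum_add_distrib, ← Finset.sum_smul, sum_prob, one_smul, Finset.sum_sub_distrib]
  abel

theorem measurable_drift : Measurable (Function.uncurry (M.drift (m := m))) := by
  refine measurable_from_prod_countable_left fun b => ?_
  have hprior := measurable_gradient (fun η => Real.log (M.prior η))
  have hprod := measurable_gradient (fun η => Real.log (∏ s', M.q s' η))
  have hsurr : Measurable (M.gradSurr b.1) := measurable_gradient _
  have hlik : Measurable (fun θ => ∑ j, M.gradLik b.1 (b.2 j) θ) :=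
    Finset.measurable_fun_sum _ fun j _ => measurable_gradient _
  exact (hprior.add (hlik.const_smul ((M.N b.1 : ℝ) / (M.prob b.1 * m)))).add
    (hprod.sub (hsurr.const_smul (M.prob b.1)⁻¹))

open Asymptotics in
theorem isBigO_drift_sub_gradient_logPost
    (hq : ∀ s, ∃ K : NNReal, LipschitzWith K (fun θ => Real.log (M.q s θ))) {γ : Fin S → ℝ}
    (hγ : ∀ s i θ, ‖M.gradLik s i θ‖ ≤ γ s) (b : M.Batch m) :
    (fun θ => M.drift θ b - ∇ M.logPost θ) =O[⊤] fun _ => (1 : ℝ) := by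
  have hlik : ∀ s i, M.gradLik s i =O[⊤] fun _ => (1 : ℝ) := fun s i =>
    isBigO_top.2 ⟨γ s, fun θ => by simpa only [norm_one, mul_one] using hγ s i θ⟩
  have hsurr : ∀ s, M.gradSurr s =O[⊤] fun _ => (1 : ℝ) := fun s => by
    obtain ⟨K, hK⟩ := hq s
    exact isBigO_top.2 ⟨K, fun θ => by
      simpa only [norm_one, mul_one, gradSurr] using norm_gradient_le_of_lipschitzWith hK θ⟩
  have hsplit : (fun θ => M.drift θ b - ∇ M.logPost θ) = fun θ =>
      ((M.N b.1 : ℝ) / (M.prob b.1 * m)) • ∑ j, M.gradLik b.1 (b.2 j) θ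
        - ∑ s, ∑ i, M.gradLik s i θ
        + (∑ s, M.gradSurr s θ - (M.prob b.1)⁻¹ • M.gradSurr b.1 θ) := by
    ext1 θ
    rw [drift, dsgldGrad, conduciveGrad, gradient_log_prod_surrogate, gradient_logPost]
    abel
  have hbatch_sum : (fun θ => ∑ j, M.gradLik b.1 (b.2 j) θ) =O[⊤] fun _ => (1 : ℝ) :=
    IsBigO.fun_sum fun j _ => hlik _ _
  have hlik_sum : (fun θ => ∑ s, ∑ i, M.gradLik s i θ) =O[⊤] fun _ => (1 : ℝ) :=
    IsBigO.fun_sum fun s _ => IsBigO.fun_sum fun i _ => hlik s i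
  have hsurr_sum : (fun θ => ∑ s, M.gradSurr s θ) =O[⊤] fun _ => (1 : ℝ) :=
    IsBigO.fun_sum fun s _ => hsurr s
  rw [hsplit]
  exact ((hbatch_sum.const_smul_left ((M.N b.1 : ℝ) / (M.prob b.1 * m))).sub hlik_sum).add
    (hsurr_sum.sub ((hsurr b.1).const_smul_left (M.prob b.1)⁻¹))

theorem exists_norm_drift_le
    (hq : ∀ s, ∃ K : NNReal, LipschitzWith K (fun θ => Real.log (M.q s θ))) {γ : Fin S → ℝ}
    (hγ : ∀ s i θ, ‖M.gradLik s i θ‖ ≤ γ s) :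
    ∃ C : ℝ, ∀ θ (b : M.Batch m), ‖M.drift θ b‖ ≤ ‖∇ M.logPost θ‖ + C := by
  choose c hc using fun b : M.Batch m =>
    Asymptotics.isBigO_top.1 (M.isBigO_drift_sub_gradient_logPost hq hγ b)
  obtain ⟨C, hC⟩ := (Set.finite_range c).bddAbove
  refine ⟨C, fun θ b => (norm_le_norm_add_norm_sub' _ _).trans (add_le_add_right ?_ _)⟩
  have hcθ := hc b θ
  rw [norm_one, mul_one] at hcθ
  exact hcθ.trans (hC (Set.mem_range_self b))

end Batch

section Chain

variable {m : ℕ} {Ω : Type*} [MeasurableSpace Ω]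

/-- The initial state together with the noise before time `t`. It generates the `σ`-algebra of the
past of the chain. -/
def pastNoise (θ₀ : Ω → Param d) (B : ℕ → Ω → M.Batch m) (ξ : ℕ → Ω → Param d) (t : ℕ) (ω : Ω) :
    Param d × (Finset.range t → M.Batch m × Param d) :=
  (θ₀ ω, fun i => (B i ω, ξ i ω))

namespace IsDriving

variable {M} {P : Measure Ω} {θ₀ : Ω → Param d} {B : ℕ → Ω → M.Batch m} {ξ : ℕ → Ω → Param d}
  (hdrive : M.IsDriving P θ₀ B ξ)

include hdrive

theorem measurable_pair (t : ℕ) : Measurable (fun ω => (B t ω, ξ t ω)) :=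
  (hdrive.measurable_batch t).prodMk (hdrive.measurable_noise t)

theorem measurable_pastNoise (t : ℕ) : Measurable (M.pastNoise θ₀ B ξ t) :=
  hdrive.measurable_init.prodMk (measurable_pi_lambda _ fun i => hdrive.measurable_pair i)

/-- The filtration generated by the initial state and the noise, to which the chain is adapted. -/
def filtration : Filtration ℕ (inferInstance : MeasurableSpace Ω) where
  seq t := MeasurableSpace.comap (M.pastNoise θ₀ B ξ t) inferInstance
  mono' t t' htt' := by
    have hrestrict : M.pastNoise θ₀ B ξ t
        = (fun q : Param d × (Finset.range t' → M.Batch m × Param d) =>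
          (q.1, fun i : Finset.range t => q.2 ⟨i, Finset.range_mono htt' i.2⟩))
        ∘ M.pastNoise θ₀ B ξ t' := rfl
    change MeasurableSpace.comap (M.pastNoise θ₀ B ξ t) _
      ≤ MeasurableSpace.comap (M.pastNoise θ₀ B ξ t') _
    rw [hrestrict, ← MeasurableSpace.comap_comp]
    exact MeasurableSpace.comap_mono (Measurable.comap_le (by fun_prop))
  le' t := (hdrive.measurable_pastNoise t).comap_le

theorem indepFun_pastNoise [IsProbabilityMeasure P] (t : ℕ) :
    IndepFun (M.pastNoise θ₀ B ξ t) (fun ω => (B t ω, ξ t ω)) P := by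
  have hpast : Measurable (fun ω (i : Finset.range t) => (B i ω, ξ i ω)) :=
    measurable_pi_lambda _ fun i => hdrive.measurable_pair i
  have hinit : IndepFun θ₀ (fun ω => ((fun i : Finset.range t => (B i ω, ξ i ω)), (B t ω, ξ t ω)))
      P :=
    hdrive.indep_init.comp measurable_id (by fun_prop : Measurable
      fun q : ℕ → M.Batch m × Param d => ((fun i : Finset.range t => q i), q t))
  have hnoise := hdrive.iIndep.indepFun_finset (Finset.range t) {t}
    (Finset.disjoint_singleton_right.2 Finset.notMem_range_self) fun i => hdrive.measurable_pair i
  exact indepFun_prodMk_left hdrive.measurable_init hpast (hdrive.measurable_pair t) hinit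
    (hnoise.comp measurable_id
      (measurable_pi_apply (⟨t, Finset.mem_singleton_self t⟩ : ({t} : Finset ℕ))))

theorem measurable_chain_filtration (h : ℝ) (t : ℕ) :
    Measurable[hdrive.filtration t] (M.chain θ₀ B ξ h t) := by
  induction t with
  | zero => exact measurable_fst.comp (comap_measurable (M.pastNoise θ₀ B ξ 0))
  | succ t ih =>
    have hstate : Measurable[hdrive.filtration (t + 1)] (M.chain θ₀ B ξ h t) :=
      ih.mono (hdrive.filtration.mono t.le_succ) le_rfl
    have hnoise : Measurable[hdrive.filtration (t + 1)] (fun ω => (B t ω, ξ t ω)) :=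
      (by fun_prop : Measurable fun q : Param d × (Finset.range (t + 1) → M.Batch m × Param d) =>
        q.2 ⟨t, Finset.self_mem_range_succ t⟩).comp
          (comap_measurable (M.pastNoise θ₀ B ξ (t + 1)))
    exact (measurable_langevinUpdate M.measurable_drift h).comp (hstate.prodMk hnoise)

theorem isNoiseDriven [IsProbabilityMeasure P] (h : ℝ) :
    IsNoiseDriven P ((M.batchPMF m).toMeasure.prod (stdGaussian (Param d)))
      (langevinUpdate M.drift h) hdrive.filtration (M.chain θ₀ B ξ h)
      (fun t ω => (B t ω, ξ t ω)) where
  measurable_update := measurable_langevinUpdate M.measurable_drift h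
  measurable_state := hdrive.measurable_chain_filtration h
  measurable_noise := hdrive.measurable_pair
  law := hdrive.law
  indep t := (IndepFun_iff_Indep _ _ _).1 (hdrive.indepFun_pastNoise t)
  step _ _ := rfl

end IsDriving

end Chain

end FederatedModel

theorem theorem2_general {X : Type*} {d S m : ℕ} (hm : 0 < m) (M : FederatedModel X d S)
    (hq : ∀ s, ∃ K : NNReal, LipschitzWith K (fun θ => Real.log (M.q s θ)))
    (γ : Fin S → ℝ) (hγ : ∀ s i θ, ‖M.gradLik s i θ‖ ≤ γ s)
    {Ω : Type*} [MeasurableSpace Ω] (P : Measure Ω) [IsProbabilityMeasure P]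
    (θ₀ : Ω → Param d) (B : ℕ → Ω → M.Batch m) (ξ : ℕ → Ω → Param d)
    (hdrive : M.IsDriving P θ₀ B ξ)
    (H : Set ℝ) (hH : ∀ h ∈ H, 0 < h)
    (φ ψ : Param d → ℝ) (hφ : ContDiff ℝ 2 φ) (hψ : ContDiff ℝ 3 ψ)
    (m₀ : ℝ) (hpoisson : ∀ θ, M.generator ψ θ = φ θ - m₀)
    (Γ : Param d → ℝ) (hΓ : Measurable Γ) (hΓ_nonneg : ∀ θ, 0 ≤ Γ θ)
    (p : Fin 4 → ℝ) (hp : ∀ k, 0 ≤ p k) (r : ℝ) (hr : 0 ≤ r)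
    (hψ_growth : ∀ k : Fin 4, ∃ c : ℝ, ∀ θ, ‖iteratedFDeriv ℝ k ψ θ‖ ≤ c * Γ θ ^ p k)
    (hφ_growth : ∃ (k : Fin 4) (c : ℝ), ∀ θ, ‖iteratedFDeriv ℝ 2 φ θ‖ ≤ c * (1 + Γ θ ^ p k))
    (hlog : ContDiff ℝ 3 M.logPost)
    (hlog_growth : ∀ j ∈ Finset.Icc 1 3, ∃ c : ℝ, ∀ θ,
      ‖iteratedFDeriv ℝ j M.logPost θ‖ ≤ c * (1 + Γ θ ^ r))
    (hΓ_moment : ∀ k : Fin 4, ∃ c : ℝ, ∀ h ∈ H, ∀ t : ℕ,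
      Integrable (fun ω => Γ (M.chain θ₀ B ξ h t ω) ^ (2 * (p k + 2 * r))) P ∧
      ∫ ω, Γ (M.chain θ₀ B ξ h t ω) ^ (2 * (p k + 2 * r)) ∂P ≤ c)
    (hΓ_segment : ∀ k : Fin 4, ∃ c : ℝ, ∀ θ θ' : Param d, ∀ u ∈ Set.Ioo (0 : ℝ) 1,
      Γ (u • θ + (1 - u) • θ') ^ (p k + 2 * r)
        ≤ c * (Γ θ ^ (p k + 2 * r) + Γ θ' ^ (p k + 2 * r))) :
    ∃ C : ℝ, 0 ≤ C ∧ ∀ h ∈ H, ∀ T : ℕ, 0 < T →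
      Integrable (fun ω => (mcAverage φ (M.chain θ₀ B ξ h) T ω - m₀) ^ 2) P ∧
      ∫ ω, (mcAverage φ (M.chain θ₀ B ξ h) T ω - m₀) ^ 2 ∂P ≤ C * (1 / (h * T) + h ^ 2) := by
  obtain ⟨g₀, hdrift_le⟩ := M.exists_norm_drift_le (m := m) hq hγ
  exact exists_integral_mcAverage_sub_sq_le hlog hφ hψ hpoisson hΓ hΓ_nonneg hp hr hψ_growth
    hφ_growth hlog_growth M.measurable_drift (M.integral_drift hm) hdrift_le hH
    (fun h _ => hdrive.isNoiseDriven h) hΓ_moment hΓ_segment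

theorem theorem2 {X : Type*} {d S m : ℕ} (hm : 0 < m) (M : FederatedModel X d S)
    -- the posterior is proper
    (hpost : Integrable M.post)
    -- Lipschitz log-surrogates
    (hq : ∀ s, ∃ K : NNReal, LipschitzWith K (fun θ => Real.log (M.q s θ)))
    -- bounded log-likelihood gradients within each shard
    (γ : Fin S → ℝ) (hγ : ∀ s i θ, ‖M.gradLik s i θ‖ ≤ γ s)
    -- the chains, one for each step size in a set `H`
    {Ω : Type*} [MeasurableSpace Ω] (P : Measure Ω) [IsProbabilityMeasure P]
    (θ₀ : Ω → Param d) (B : ℕ → Ω → M.Batch m) (ξ : ℕ → Ω → Param d)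
    (hdrive : M.IsDriving P θ₀ B ξ)
    (H : Set ℝ) (hH : ∀ h ∈ H, 0 < h)
    -- the test function and the solution of the Poisson equation
    (φ ψ : Param d → ℝ) (hφ : ContDiff ℝ 2 φ) (hφ_int : Integrable (fun θ => φ θ * M.post θ))
    (hψ : ContDiff ℝ 3 ψ) (hpoisson : ∀ θ, M.generator ψ θ = φ θ - M.postMean φ)
    -- the dominating function and the growth exponents
    (Γ : Param d → ℝ) (hΓ : Measurable Γ) (hΓ_nonneg : ∀ θ, 0 ≤ Γ θ)
    (p : Fin 4 → ℝ) (hp : ∀ k, 0 < p k) (r : ℝ) (hr : 0 ≤ r)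
    (hψ_growth : ∀ k : Fin 4, ∃ c : ℝ, ∀ θ, ‖iteratedFDeriv ℝ k ψ θ‖ ≤ c * Γ θ ^ p k)
    (hφ_growth : ∃ (k : Fin 4) (c : ℝ), ∀ θ, ‖iteratedFDeriv ℝ 2 φ θ‖ ≤ c * (1 + Γ θ ^ p k))
    (hlog : ContDiff ℝ 3 M.logPost)
    (hlog_growth : ∀ j ∈ Finset.Icc 1 3, ∃ c : ℝ, ∀ θ,
      ‖iteratedFDeriv ℝ j M.logPost θ‖ ≤ c * (1 + Γ θ ^ r))
    (hΓ_moment : ∀ k : Fin 4, ∀ a : ℝ, 0 < a → a ≤ 2 * p k + 6 * r →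
      ∃ c : ℝ, ∀ h ∈ H, ∀ t : ℕ,
        Integrable (fun ω => Γ (M.chain θ₀ B ξ h t ω) ^ a) P ∧
        ∫ ω, Γ (M.chain θ₀ B ξ h t ω) ^ a ∂P ≤ c)
    (hΓ_segment : ∀ k : Fin 4, ∀ a : ℝ, 0 < a → a ≤ 2 * p k + 6 * r →
      ∃ c : ℝ, ∀ θ θ' : Param d, ∀ u ∈ Set.Ioo (0 : ℝ) 1,
        Γ (u • θ + (1 - u) • θ') ^ a ≤ c * (Γ θ ^ a + Γ θ' ^ a)) :
    ∃ C : ℝ, ∀ ε : Fin S → ℝ,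
      (∀ s θ, (M.N s : ℝ)⁻¹ * ∑ i, ‖M.gradLik s i θ - (M.N s : ℝ)⁻¹ • M.gradSurr s θ‖ ^ 2
        ≤ ε s ^ 2) →
      ∀ h ∈ H, ∀ T : ℕ, 0 < T →
        Integrable (fun ω => (mcAverage φ (M.chain θ₀ B ξ h) T ω - M.postMean φ) ^ 2) P ∧
        ∫ ω, (mcAverage φ (M.chain θ₀ B ξ h) T ω - M.postMean φ) ^ 2 ∂P
          ≤ C * (1 / (m * T) * ∑ s, (M.N s : ℝ) ^ 2 / M.prob s * ε s ^ 2 + 1 / (h * T) + h ^ 2) := by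
  obtain ⟨C, hC, hbound⟩ := theorem2_general hm M hq γ hγ P θ₀ B ξ hdrive H hH φ ψ hφ hψ
    (M.postMean φ) hpoisson Γ hΓ hΓ_nonneg p (fun k => (hp k).le) r hr hψ_growth hφ_growth hlog
    hlog_growth (fun k => hΓ_moment k _ (by linarith [hp k]) (by linarith))
    (fun k => hΓ_segment k _ (by linarith [hp k]) (by linarith [hp k]))
  refine ⟨C, fun ε _ h hh T hT => (hbound h hh T hT).imp_right fun hle =>
    hle.trans (mul_le_mul_of_nonneg_left ?_ hC)⟩
  rw [add_assoc]
  exact le_add_of_nonneg_left (mul_nonneg (by positivity) (Finset.sum_nonneg fun s _ =>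
    mul_nonneg (div_nonneg (sq_nonneg _) (M.prob_pos s).le) (sq_nonneg _)))
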